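/- Let $n\ge 1$, $\Theta>0$, let $\gamma_1,\dots,\gamma_n>0$ with $\sum_{k=1}^n\gamma_k=1$, let $\mu_1,\dots,\mu_n$ be Borel probability measures on $\mathbb R$ and $\mu=\mu_1\otimes\cdots\otimes\mu_n$. For a Borel probability measure $\nu$ on $\mathbb R^n$ let $\nu^{(k)}$ be its marginal on the first $k$ coordinates, let $H(\cdot\mid\cdot)$ denote relative entropy ($H(\nu\mid\mu)=\int\log\frac{d\nu}{d\mu}\,d\nu$ if $\nu\ll\mu$, and $+\infty$ otherwise), and let $$\mathcal K=\Big\{\nu:\ H(\nu^{(k)}\mid\mu^{(k)})\le\Theta\log 2\sum_{j=1}^k\gamma_j\ \text{ for all } k=1,\dots,n\Big\}.$$ Let $\varphi,f:\mathbb R^n\to\mathbb R$ be bounded and Borel measurable, and let $\Phi:\mathbb R\to\mathbb R$ be twice differentiable with $\Phi''(x)<0$ for all $x\in[\inf\varphi,\sup\varphi]$. Put $\boldsymbol\Phi[\nu]=\Phi\big(\int\varphi\,d\nu\big)+\int f\,d\nu$. Let $\Delta=\{\mathbf m\in\mathbb R^n: 0<m_1\le\dots\le m_n\le 1\}$, and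 for $q\in[\inf\varphi,\sup\varphi]$, $\mathbf m\in\Delta$ define $$P_n^{q,\mathbf m}=\Phi'(q)\varphi+f,\qquad P_{j-1}^{q,\mathbf m}(x_1,\dots,x_{j-1})=\frac1{m_j}\log\int e^{m_jP_j^{q,\mathbf m}(x_1,\dots,x_j)}\,\mu_j(dx_j)\quad(j=n,\dots,1),$$ $$P(q,\mathbf m)=\Phi(q)-q\Phi'(q)+P_0^{q,\mathbf m}+\sum_{k=1}^n\frac{\gamma_k\Theta\log 2}{m_k}-\Theta\log 2.$$ Then $$\sup_{\nu\in\mathcal K}\big(\boldsymbol\Phi[\nu]-H(\nu\mid\mu)\big)=\inf_{(q,\mathbf m)\in[\inf\varphi,\sup\varphi]\times\Delta}P(q,\mathbf m).$$ Moreover, the infimum is attained, and for every minimum point $(\bar q,\bar{\mathbf m})$ of $P$ on $[\inf\varphi,\sup\varphi]\times\Delta$ the measure $G$ with $$\frac{dG}{d\mu}(x_1,\dots,x_n)=\prod_{j=1}^n\frac{e^{\bar m_jP_j^{\bar q,\bar{\mathbf m}}(x_1,\dots,x_j)}}{\int e^{\bar m_jP_j^{\bar q,\bar{\mathbf m}}(x_1,\dots,x_{j-1},x_j')}\,\mu_j(dx_j')}$$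 is a probability measure in $\mathcal K$ and is the unique maximizer of $\boldsymbol\Phi[\nu]-H(\nu\mid\mu)$ over $\nu\in\mathcal K$. -/

import Mathlib

open MeasureTheory

noncomputable section

namespace GREM

variable {n : ℕ}

/-- The law `ν^(k)` of the first `k` coordinates under a measure `ν` on `ℝⁿ`, for `k ≤ n`. -/
def marginal (k : ℕ) (hk : k ≤ n) (ν : Measure (Fin n → ℝ)) : Measure (Fin k → ℝ) :=
  ν.map (fun x => Fin.take k hk x)

/-- The set `𝒦` of Borel probability measures `ν` on `ℝⁿ` whose marginals satisfy
`H(ν^(k) ∣ μ^(k)) ≤ Θ log 2 ∑_{j ≤ k} γ_j` for `k = 1, …, n`, where `μ` is the product of the `μ_k`.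
The index `k : Fin n` stands for the `(k+1)`-st coordinate. -/
def admissible (Θ : ℝ) (γ : Fin n → ℝ) (μ : Fin n → Measure ℝ) : Set (Measure (Fin n → ℝ)) :=
  {ν | IsProbabilityMeasure ν ∧
    ∀ k : Fin n,
      InformationTheory.klDiv (marginal (k + 1) k.isLt ν)
          (marginal (k + 1) k.isLt (Measure.pi μ)) ≤
        ENNReal.ofReal (Θ * Real.log 2 * ∑ j ∈ Finset.Iic k, γ j)}

/-- `Φ(∫ φ dν) + ∫ f dν - H(ν ∣ μ)`. It is only used for `ν ∈ 𝒦`, where the relative entropy is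
finite. -/
def gibbs (Φ : ℝ → ℝ) (φ f : (Fin n → ℝ) → ℝ) (μ : Fin n → Measure ℝ)
    (ν : Measure (Fin n → ℝ)) : ℝ :=
  Φ (∫ x, φ x ∂ν) + ∫ x, f x ∂ν - (InformationTheory.klDiv ν (Measure.pi μ)).toReal

/-- The functions `P_j(x_1, …, x_j)`, `j = 0, …, n`, with `P_n = g` and
`P_{j-1}(x_1, …, x_{j-1}) = (1 / m_j) log ∫ exp (m_j P_j(x_1, …, x_{j-1}, y)) μ_j(dy)`. -/
def level (μ : Fin n → Measure ℝ) (m : Fin n → ℝ) (g : (Fin n → ℝ) → ℝ) (j : Fin (n + 1)) :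
    (Fin (j : ℕ) → ℝ) → ℝ :=
  Fin.reverseInduction (motive := fun j : Fin (n + 1) => (Fin (j : ℕ) → ℝ) → ℝ)
    g
    (fun (j : Fin n) (P : (Fin ((j : ℕ) + 1) → ℝ) → ℝ) (x : Fin (j : ℕ) → ℝ) =>
      (1 / m j) *
        Real.log (∫ y, Real.exp (m j * P (Fin.snoc (α := fun _ => ℝ) x y)) ∂(μ j)))
    j

/-- The terminal function `P_n^{q,m} = Φ'(q) φ + f`. -/
def terminal (Φ : ℝ → ℝ) (φ f : (Fin n → ℝ) → ℝ) (q : ℝ) (x : Fin n → ℝ) : ℝ :=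
  deriv Φ q * φ x + f x

/-- `Δ = {m : 0 < m_1 ≤ … ≤ m_n ≤ 1}`. -/
def simplex (n : ℕ) : Set (Fin n → ℝ) :=
  {m | (∀ j, 0 < m j ∧ m j ≤ 1) ∧ Monotone m}

/-- `[inf φ, sup φ] × Δ`. -/
def domain (φ : (Fin n → ℝ) → ℝ) : Set (ℝ × (Fin n → ℝ)) :=
  Set.Icc (⨅ x, φ x) (⨆ x, φ x) ×ˢ simplex n

/-- The Parisi function `P(q, m)`, with `p = (q, m)`. -/
def parisi (Θ : ℝ) (γ : Fin n → ℝ) (Φ : ℝ → ℝ) (φ f : (Fin n → ℝ) → ℝ) (μ : Fin n → Measure ℝ)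
    (p : ℝ × (Fin n → ℝ)) : ℝ :=
  Φ p.1 - p.1 * deriv Φ p.1 + level μ p.2 (terminal Φ φ f p.1) 0 (fun i : Fin 0 => i.elim0)
    + ∑ k, γ k * Θ * Real.log 2 / p.2 k - Θ * Real.log 2

/-- The probability measure `G^{q,m}` with density
`∏_j exp (m_j P_j(x_1, …, x_j)) / ∫ exp (m_j P_j(x_1, …, x_{j-1}, y)) μ_j(dy)`
with respect to the product measure `μ`, with `p = (q, m)`. -/
def tilted (Φ : ℝ → ℝ) (φ f : (Fin n → ℝ) → ℝ) (μ : Fin n → Measure ℝ)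
    (p : ℝ × (Fin n → ℝ)) : Measure (Fin n → ℝ) :=
  (Measure.pi μ).withDensity fun x => ENNReal.ofReal <|
    ∏ j : Fin n,
      Real.exp (p.2 j * level μ p.2 (terminal Φ φ f p.1) j.succ
          (Fin.take ((j : ℕ) + 1) j.isLt x)) /
        ∫ y, Real.exp (p.2 j * level μ p.2 (terminal Φ φ f p.1) j.succ
          (Fin.snoc (α := fun _ => ℝ) (Fin.take (j : ℕ) j.isLt.le x) y)) ∂(μ j)

end GREM

end

namespace GREM

open Filter Topology InformationTheory

/-! ### Gibbs' variational principle for bounded log-densities -/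

section KullbackLeibler

variable {α : Type*} [MeasurableSpace α]

/-! The theorem is Lagrangian duality, made visible by the substitution 1/m_j = 1 + ∑_{i≥j} c_i,
which turns Δ into the orthant c ≥ 0 of multipliers for the n entropy constraints. Let L_k be the
log-density of the k-th marginal of the tilted measure G. Telescoping the recursion and summing by
parts gives g = P_0 + L_n + ∑ c_i L_i pointwise (`eq_value_zero_add`). Gibbs' inequality says ∫ L_k
dν ≤ H(ν^(k) | μ^(k)), with equality at ν = G. Hence P_0 is the maximum of ∫ g dν - H(ν | μ) - ∑ c_i
H(ν^(i) | μ^(i)), and with the tangent bound for the concave Φ this yields weak duality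
(`gibbs_le_parisi_add`).

For the converse, P is coercive in c, so a minimum exists. No derivative of P is computed: using the
maximizer of one parameter as a competitor for another bounds increments of P from above
(`parisi_sub_le`), and continuity of G in the parameters turns this into first-order conditions.
They read ∫ φ dG = q, H(G^(k) | μ^(k)) ≤ budget, and equality wherever c_k > 0. These conditions
make G admissible and close the duality gap. Uniqueness is the equality case of Gibbs' inequality
for L_n, whose coefficient is 1 whatever c is. -/

lemma integrable_of_abs_le {ν : Measure α} [IsFiniteMeasure ν] {F : α → ℝ} (hF : Measurable F)
    {C : ℝ} (hC : ∀ x, |F x| ≤ C) : Integrable F ν :=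
  Integrable.of_bound hF.aestronglyMeasurable C (Eventually.of_forall hC)

lemma integrable_exp_of_abs_le {ν : Measure α} [IsFiniteMeasure ν] {F : α → ℝ} (hF : Measurable F)
    {C : ℝ} (hC : ∀ x, |F x| ≤ C) : Integrable (fun x => Real.exp (F x)) ν :=
  integrable_of_abs_le hF.exp (C := Real.exp C) fun x => by
    rw [Real.abs_exp]; exact Real.exp_le_exp.2 (abs_le.1 (hC x)).2

lemma tilted_eq_withDensity_of_integral_eq_one {μ : Measure α} {F : α → ℝ}
    (h1 : ∫ x, Real.exp (F x) ∂μ = 1) :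
    μ.tilted F = μ.withDensity fun x => ENNReal.ofReal (Real.exp (F x)) := by
  simp [Measure.tilted, h1]

/-- Gibbs' variational inequality with its case of equality. -/
lemma integral_le_toReal_klDiv {ν μ : Measure α} [IsProbabilityMeasure ν] [IsProbabilityMeasure μ]
    {F : α → ℝ} (hF : Measurable F) {C : ℝ} (hC : ∀ x, |F x| ≤ C)
    (h1 : ∫ x, Real.exp (F x) ∂μ = 1) (hfin : klDiv ν μ ≠ ⊤) :
    ∫ x, F x ∂ν ≤ (klDiv ν μ).toReal ∧
      ((klDiv ν μ).toReal = ∫ x, F x ∂ν →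
        ν = μ.withDensity fun x => ENNReal.ofReal (Real.exp (F x))) := by
  obtain ⟨hac, hint⟩ := klDiv_ne_top_iff.1 hfin
  have hexp : Integrable (fun x => Real.exp (F x)) μ := integrable_exp_of_abs_le hF hC
  have hFν : Integrable F ν := integrable_of_abs_le hF hC
  have : IsProbabilityMeasure (μ.tilted F) := isProbabilityMeasure_tilted hexp
  have hac' : ν ≪ μ.tilted F := hac.trans (absolutelyContinuous_tilted hexp)
  have hint' := integrable_llr_tilted_right hac hFν hint hexp
  have e1 := toReal_klDiv_of_measure_eq hac (by simp)
  have e2 := toReal_klDiv_of_measure_eq hac' (by simp)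
  have e3 := integral_llr_tilted_right hac hFν hexp hint
  -- With `F` normalized, `e1`, `e2` and `e3` combine to H(ν | μ) - ∫ F dν = H(ν | e^F μ); both
  -- claims follow from this identity.
  rw [h1, Real.log_one] at e3
  have e4 : 0 ≤ (klDiv ν (μ.tilted F)).toReal := ENNReal.toReal_nonneg
  refine ⟨by linarith, fun h => ?_⟩
  have : (klDiv ν (μ.tilted F)).toReal = 0 := by linarith
  rw [ENNReal.toReal_eq_zero_iff, or_iff_left (klDiv_ne_top hac' hint'), klDiv_eq_zero_iff] at this
  rw [this, tilted_eq_withDensity_of_integral_eq_one h1]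

/-- The log-likelihood ratio is `F` almost everywhere. The sign of the integral is recorded so that
`ENNReal.ofReal` can be undone later. -/
lemma klDiv_withDensity_exp {μ : Measure α} [IsProbabilityMeasure μ]
    {F : α → ℝ} (hF : Measurable F) {C : ℝ} (hC : ∀ x, |F x| ≤ C)
    (h1 : ∫ x, Real.exp (F x) ∂μ = 1) :
    klDiv (μ.withDensity fun x => ENNReal.ofReal (Real.exp (F x))) μ =
      ENNReal.ofReal (∫ x, F x ∂(μ.withDensity fun x => ENNReal.ofReal (Real.exp (F x)))) ∧
    0 ≤ ∫ x, F x ∂(μ.withDensity fun x => ENNReal.ofReal (Real.exp (F x))) := by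
  have hexp : Integrable (fun x => Real.exp (F x)) μ := integrable_exp_of_abs_le hF hC
  rw [← tilted_eq_withDensity_of_integral_eq_one h1]
  have : IsProbabilityMeasure (μ.tilted F) := isProbabilityMeasure_tilted hexp
  have hac : μ.tilted F ≪ μ := tilted_absolutelyContinuous μ F
  have hllr : llr (μ.tilted F) μ =ᵐ[μ.tilted F] F := by
    filter_upwards [hac.ae_le (log_rnDeriv_tilted_left_self hexp)] with x hx
    simp only [llr, hx, h1, Real.log_one, sub_zero]
  have hint := (integrable_congr hllr).2 (integrable_of_abs_le hF hC)
  have h0 := integral_llr_add_sub_measure_univ_nonneg hac hint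
  rw [integral_congr_ae hllr] at h0
  rw [klDiv_of_ac_of_integrable hac hint, integral_congr_ae hllr]
  simpa using h0

end KullbackLeibler

/-! ### The recursion for P_j: locality, bounds, continuity -/

section Levels

variable {n : ℕ}

/-- `level`, as a function of all coordinates. -/
noncomputable def value (μ : Fin n → Measure ℝ) (m : Fin n → ℝ) (g : (Fin n → ℝ) → ℝ)
    (j : Fin (n + 1)) (x : Fin n → ℝ) : ℝ :=
  level μ m g j (Fin.take j (Nat.le_of_lt_succ j.isLt) x)

variable (μ : Fin n → Measure ℝ) (m : Fin n → ℝ) (g : (Fin n → ℝ) → ℝ)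

lemma value_last (x : Fin n → ℝ) : value μ m g (Fin.last n) x = g x := by
  unfold value level
  rw [Fin.reverseInduction_last]
  rfl

lemma take_succ_update (j : Fin n) (x : Fin n → ℝ) (y : ℝ) :
    Fin.take ((j : ℕ) + 1) j.isLt (Function.update x j y) =
      Fin.snoc (α := fun _ => ℝ) (Fin.take (j : ℕ) j.isLt.le x) y := by
  have := Fin.take_succ_eq_snoc (α := fun _ => ℝ) (j : ℕ) j.isLt (Function.update x j y)
  rw [Fin.take_update_of_ge (α := fun _ => ℝ) (j : ℕ) j.isLt.le x j le_rfl y] at this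
  simpa using this

lemma value_castSucc (j : Fin n) (x : Fin n → ℝ) :
    value μ m g j.castSucc x =
      (1 / m j) * Real.log (∫ y, Real.exp (m j * value μ m g j.succ (Function.update x j y)) ∂μ j)
      := by
  have h : level μ m g j.castSucc = fun x : Fin (j : ℕ) → ℝ => (1 / m j) *
      Real.log (∫ y, Real.exp (m j * level μ m g j.succ (Fin.snoc (α := fun _ => ℝ) x y)) ∂μ j) := by
    unfold level
    rw [Fin.reverseInduction_castSucc]
  unfold value
  rw [h]
  have e : ∀ y, Fin.take (j.succ : ℕ) (Nat.le_of_lt_succ j.succ.isLt) (Function.update x j y) =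
      Fin.snoc (α := fun _ => ℝ) (Fin.take (j : ℕ) j.isLt.le x) y := take_succ_update j x
  simp only [e]
  rfl

lemma value_zero (x : Fin n → ℝ) : value μ m g 0 x = level μ m g 0 (fun i : Fin 0 => i.elim0) := by
  unfold value
  congr 1
  funext i
  exact Fin.elim0 i

/-- Placing all levels on ℝⁿ hides that level j sees only the first j coordinates; this recovers it.
-/
lemma value_congr {j : Fin (n + 1)} {x x' : Fin n → ℝ}
    (h : ∀ i : Fin n, (i : ℕ) < j → x i = x' i) : value μ m g j x = value μ m g j x' := by
  unfold value
  congr 1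
  funext i
  exact h _ (by simp)

lemma measurable_update_prod (j : Fin n) :
    Measurable fun p : (Fin n → ℝ) × ℝ => Function.update p.1 j p.2 := by
  refine measurable_pi_iff.2 fun i => ?_
  by_cases h : i = j
  · subst h; simpa using measurable_snd
  · simpa [Function.update_of_ne h] using measurable_fst.eval

variable [∀ k, IsProbabilityMeasure (μ k)]
variable {μ m g}

lemma measurable_value (hg : Measurable g) (j : Fin (n + 1)) : Measurable (value μ m g j) := by
  induction j using Fin.reverseInduction with
  | last => simpa [funext (value_last μ m g)] using hg
  | cast j ih =>
    have h : Measurable fun x => ∫ y, Real.exp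
        (m j * value μ m g j.succ (Function.update x j y)) ∂μ j := by
      refine StronglyMeasurable.measurable ?_
      refine StronglyMeasurable.integral_prod_right (f := fun x y => Real.exp
        (m j * value μ m g j.succ (Function.update x j y))) ?_
      exact (((ih.comp (measurable_update_prod j)).const_mul _).exp).stronglyMeasurable
    rw [funext (value_castSucc μ m g j)]
    exact h.log.const_mul _

/-- Each step is an exponential mean, which preserves bounds. The constant depends neither on the
level nor on m, so it can serve in dominated convergence as the parameters vary. -/
lemma abs_value_le (hm : ∀ j, 0 < m j) (hg : Measurable g) {C : ℝ} (hC : ∀ x, |g x| ≤ C)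
    (j : Fin (n + 1)) (x : Fin n → ℝ) : |value μ m g j x| ≤ C := by
  induction j using Fin.reverseInduction generalizing x with
  | last => simpa [value_last] using hC x
  | cast j ih =>
    have hb : ∀ y, Real.exp (-(m j * C)) ≤
          Real.exp (m j * value μ m g j.succ (Function.update x j y)) ∧
        Real.exp (m j * value μ m g j.succ (Function.update x j y)) ≤ Real.exp (m j * C) := by
      intro y
      obtain ⟨h1, h2⟩ := abs_le.1 (ih (Function.update x j y))
      constructor <;> apply Real.exp_le_exp.2 <;> nlinarith [hm j]
    have hint : Integrable
        (fun y => Real.exp (m j * value μ m g j.succ (Function.update x j y))) (μ j) := by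
      refine integrable_of_abs_le (C := Real.exp (m j * C)) ?_ fun y => ?_
      · exact (((measurable_value hg j.succ).comp (measurable_update x)).const_mul _).exp
      · rw [Real.abs_exp]; exact (hb y).2
    have h1 := integral_mono (μ := μ j) (integrable_const _) hint fun y => (hb y).1
    have h2 := integral_mono (μ := μ j) hint (integrable_const _) fun y => (hb y).2
    simp only [integral_const, probReal_univ, one_smul] at h1 h2
    have h1' := Real.log_le_log (Real.exp_pos _) h1
    have h2' := Real.log_le_log ((Real.exp_pos _).trans_le h1) h2
    rw [Real.log_exp] at h1' h2'
    rw [value_castSucc, abs_le, one_div, inv_mul_eq_div, le_div_iff₀ (hm j), div_le_iff₀ (hm j)]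
    constructor <;> linarith

lemma measurable_value_update (hg : Measurable g) (j : Fin (n + 1)) (i : Fin n) (x : Fin n → ℝ) :
    Measurable fun y => value μ m g j (Function.update x i y) :=
  (measurable_value hg j).comp (measurable_update x)

lemma integrable_exp_value (hm : ∀ j, 0 < m j) (hg : Measurable g) {C : ℝ}
    (hC : ∀ x, |g x| ≤ C) (j : Fin n) (x : Fin n → ℝ) :
    Integrable (fun y => Real.exp (m j * value μ m g j.succ (Function.update x j y))) (μ j) := by
  refine integrable_exp_of_abs_le (C := m j * C) ((measurable_value_update hg j.succ j x).const_mul _)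
    fun y => ?_
  rw [abs_mul, abs_of_pos (hm j)]
  exact mul_le_mul_of_nonneg_left (abs_value_le hm hg hC _ _) (hm j).le

/-- The recursion in multiplicative form: the denominators in the density of G are exponentials of
the previous level. -/
lemma integral_exp_value (hm : ∀ j, 0 < m j) (hg : Measurable g) {C : ℝ}
    (hC : ∀ x, |g x| ≤ C) (j : Fin n) (x : Fin n → ℝ) :
    ∫ y, Real.exp (m j * value μ m g j.succ (Function.update x j y)) ∂μ j =
      Real.exp (m j * value μ m g j.castSucc x) := by
  have := hm j
  rw [value_castSucc, ← mul_assoc, mul_one_div_cancel this.ne', one_mul, Real.exp_log]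
  exact integral_exp_pos (integrable_exp_value hm hg hC j x)

/-- Pointwise continuity of the levels in the parameters. -/
lemma tendsto_value {ι : Type*} {l : Filter ι} [l.IsCountablyGenerated]
    {m' : ι → Fin n → ℝ} {g' : ι → (Fin n → ℝ) → ℝ} {C : ℝ}
    (hm : ∀ j, 0 < m j) (hg : Measurable g) (hC : ∀ x, |g x| ≤ C)
    (hm' : ∀ᶠ i in l, ∀ j, 0 < m' i j) (hg' : ∀ i, Measurable (g' i))
    (hC' : ∀ᶠ i in l, ∀ x, |g' i x| ≤ C) (hlim : ∀ j, Tendsto (fun i => m' i j) l (𝓝 (m j)))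
    (hlimg : ∀ x, Tendsto (fun i => g' i x) l (𝓝 (g x))) (j : Fin (n + 1)) (x : Fin n → ℝ) :
    Tendsto (fun i => value μ (m' i) (g' i) j x) l (𝓝 (value μ m g j x)) := by
  induction j using Fin.reverseInduction generalizing x with
  | last => simpa only [value_last] using hlimg x
  | cast j ih =>
    simp only [value_castSucc]
    refine (tendsto_const_nhds.div (hlim j) (hm j).ne').mul (Tendsto.log ?_ ?_)
    · refine tendsto_integral_filter_of_dominated_convergence
        -- Near the limit the varying parameter stays below m_j + 1, which gives an integrable
        -- constant bound.
        (fun _ => Real.exp ((m j + 1) * C)) ?_ ?_ (integrable_const _) ?_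
      · exact Eventually.of_forall fun i =>
          ((measurable_value_update (hg' i) _ j x).const_mul _).exp.aestronglyMeasurable
      · filter_upwards [hm', hC', (hlim j).eventually_lt_const (lt_add_one (m j))] with i h1 h2 h3
        refine Eventually.of_forall fun y => ?_
        have h4 := abs_value_le (μ := μ) h1 (hg' i) h2 j.succ (Function.update x j y)
        rw [Real.norm_eq_abs, Real.abs_exp, Real.exp_le_exp]
        have h5 := abs_nonneg (value μ (m' i) (g' i) j.succ (Function.update x j y))
        have h6 := le_abs_self (value μ (m' i) (g' i) j.succ (Function.update x j y))
        nlinarith [h1 j]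
      · exact Eventually.of_forall fun y =>
          (Real.continuous_exp.tendsto _).comp ((hlim j).mul (ih _))
    · exact (integral_exp_pos (integrable_exp_value hm hg hC j x)).ne'

end Levels

/-! ### The tilted measure, its marginals and their entropies -/

section LogDensity

variable {n : ℕ}

/-- The logarithm of the density of the first `k` coordinates under the tilted measure. -/
noncomputable def logDensity (μ : Fin n → Measure ℝ) (m : Fin n → ℝ) (g : (Fin n → ℝ) → ℝ)
    (k : ℕ) (x : Fin n → ℝ) : ℝ :=
  ∑ j ∈ Finset.univ.filter (fun j : Fin n => (j : ℕ) < k), m j * (value μ m g j.succ x - value μ m g j.castSucc x)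

/-- The tilt of the first `k` coordinates of the product measure. -/
noncomputable def tilt (μ : Fin n → Measure ℝ) (m : Fin n → ℝ) (g : (Fin n → ℝ) → ℝ)
    (k : ℕ) : Measure (Fin n → ℝ) :=
  (Measure.pi μ).withDensity fun x => ENNReal.ofReal (Real.exp (logDensity μ m g k x))

/-- Extension of a `k`-tuple by zeros. -/
def pad (k : ℕ) (z : Fin k → ℝ) (i : Fin n) : ℝ := if h : (i : ℕ) < k then z ⟨i, h⟩ else 0

lemma measurable_take (k : ℕ) (hk : k ≤ n) :
    Measurable fun x : Fin n → ℝ => Fin.take (α := fun _ => ℝ) k hk x :=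
  measurable_pi_iff.2 fun _ => measurable_pi_apply _

lemma measurable_pad (k : ℕ) : Measurable (pad k : (Fin k → ℝ) → Fin n → ℝ) := by
  refine measurable_pi_iff.2 fun i => ?_
  unfold pad
  split_ifs
  · exact measurable_pi_apply _
  · exact measurable_const

lemma logDensity_congr (μ : Fin n → Measure ℝ) (m : Fin n → ℝ) (g : (Fin n → ℝ) → ℝ)
    {k : ℕ} {x x' : Fin n → ℝ} (h : ∀ i : Fin n, (i : ℕ) < k → x i = x' i) :
    logDensity μ m g k x = logDensity μ m g k x' := by
  refine Finset.sum_congr rfl fun j hj => ?_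
  have hj : (j : ℕ) < k := by simpa using hj
  rw [value_congr μ m g (j := j.succ) (x := x) (x' := x'),
    value_congr μ m g (j := j.castSucc) (x := x) (x' := x')]
  · intro i hi; exact h i (by simp at hi; omega)
  · intro i hi; exact h i (by simp at hi; omega)

/-- The padding value is irrelevant by locality, so composing with `pad` turns the log-density into
a function on ℝᵏ. -/
lemma logDensity_pad_take (μ : Fin n → Measure ℝ) (m : Fin n → ℝ) (g : (Fin n → ℝ) → ℝ)
    (k : ℕ) (hk : k ≤ n) (x : Fin n → ℝ) :
    logDensity μ m g k (pad k (Fin.take k hk x)) = logDensity μ m g k x :=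
  logDensity_congr μ m g fun i hi => by simp [pad, hi]

lemma logDensity_zero (μ : Fin n → Measure ℝ) (m : Fin n → ℝ) (g : (Fin n → ℝ) → ℝ)
    (x : Fin n → ℝ) : logDensity μ m g 0 x = 0 := by
  simp [logDensity]

lemma filter_val_lt_succ (j : Fin n) :
    (Finset.univ.filter fun i : Fin n => (i : ℕ) < j + 1) =
      insert j (Finset.univ.filter fun i : Fin n => (i : ℕ) < j) := by
  ext i
  simp only [Finset.mem_filter, Finset.mem_univ, true_and, Finset.mem_insert, Fin.ext_iff]
  omega

lemma logDensity_succ (μ : Fin n → Measure ℝ) (m : Fin n → ℝ) (g : (Fin n → ℝ) → ℝ)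
    (j : Fin n) (x : Fin n → ℝ) :
    logDensity μ m g (j + 1) x =
      m j * (value μ m g j.succ x - value μ m g j.castSucc x) + logDensity μ m g j x := by
  unfold logDensity
  rw [filter_val_lt_succ, Finset.sum_insert (by simp)]

/-- Resampling one coordinate independently preserves a product of probability measures. -/
lemma lintegral_pi_eq_lintegral_update (μ : Fin n → Measure ℝ) [∀ k, IsProbabilityMeasure (μ k)]
    {h : (Fin n → ℝ) → ENNReal} (hh : Measurable h) (j : Fin n) :
    ∫⁻ x, h x ∂Measure.pi μ =
      ∫⁻ x, ∫⁻ y, h (Function.update x j y) ∂μ j ∂Measure.pi μ := by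
  have hm : Measurable fun x => ∫⁻ y, h (Function.update x j y) ∂μ j :=
    (hh.comp (measurable_update_prod j)).lintegral_prod_right'
  refine lintegral_eq_of_lmarginal_eq {j} hh hm ?_
  rw [lmarginal_singleton, lmarginal_singleton]
  simp

variable {μ : Fin n → Measure ℝ} {m : Fin n → ℝ} {g : (Fin n → ℝ) → ℝ}
variable [∀ k, IsProbabilityMeasure (μ k)]

lemma measurable_logDensity (hg : Measurable g) (k : ℕ) : Measurable (logDensity μ m g k) :=
  Finset.measurable_fun_sum _ fun _ _ =>
    ((measurable_value hg _).sub (measurable_value hg _)).const_mul _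

lemma measurable_logDensity_pad (hg : Measurable g) (k : ℕ) :
    Measurable fun z : Fin k → ℝ => logDensity μ m g k (pad k z) :=
  (measurable_logDensity hg k).comp (measurable_pad k)

lemma abs_logDensity_le (hm : ∀ j, 0 < m j) (hm1 : ∀ j, m j ≤ 1) (hg : Measurable g) {C : ℝ}
    (hC : ∀ x, |g x| ≤ C) (k : ℕ) (x : Fin n → ℝ) : |logDensity μ m g k x| ≤ n * (C + C) := by
  have hC0 : 0 ≤ C := (abs_nonneg _).trans (hC 0)
  calc |logDensity μ m g k x|
      ≤ ∑ j ∈ Finset.univ.filter (fun j : Fin n => (j : ℕ) < k),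
          |m j * (value μ m g j.succ x - value μ m g j.castSucc x)| := Finset.abs_sum_le_sum_abs _ _
    _ ≤ ∑ j ∈ Finset.univ.filter (fun j : Fin n => (j : ℕ) < k), (C + C) := by
        refine Finset.sum_le_sum fun j _ => ?_
        have h : |value μ m g j.succ x - value μ m g j.castSucc x| ≤ C + C :=
          (abs_sub _ _).trans (add_le_add (abs_value_le hm hg hC _ _) (abs_value_le hm hg hC _ _))
        rw [abs_mul, abs_of_pos (hm j)]
        nlinarith [hm j, hm1 j, abs_nonneg (value μ m g j.succ x - value μ m g j.castSucc x)]
    _ ≤ ∑ _j : Fin n, (C + C) :=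
        Finset.sum_le_sum_of_subset_of_nonneg (Finset.filter_subset _ _) fun _ _ _ => by positivity
    _ = n * (C + C) := by simp [mul_add]

/-- Each factor of the density is a conditional probability density of coordinate j given the
earlier ones. -/
lemma lintegral_exp_increment (hm : ∀ j, 0 < m j) (hg : Measurable g) {C : ℝ}
    (hC : ∀ x, |g x| ≤ C) (j : Fin n) (x : Fin n → ℝ) :
    ∫⁻ y, ENNReal.ofReal (Real.exp (m j * (value μ m g j.succ (Function.update x j y) -
      value μ m g j.castSucc x))) ∂μ j = 1 := by
  have e : ∀ y, Real.exp (m j * (value μ m g j.succ (Function.update x j y) -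
      value μ m g j.castSucc x)) = Real.exp (m j * value μ m g j.succ (Function.update x j y)) *
        Real.exp (-(m j * value μ m g j.castSucc x)) := fun y => by
    rw [← Real.exp_add]; ring_nf
  simp only [e]
  rw [← ofReal_integral_eq_lintegral_ofReal
    ((integrable_exp_value hm hg hC j x).mul_const _)
    (Eventually.of_forall fun y => by positivity), integral_mul_const,
    integral_exp_value hm hg hC, ← Real.exp_add]
  simp

lemma lintegral_tilt (hg : Measurable g) (k : ℕ) {h : (Fin n → ℝ) → ENNReal} (hh : Measurable h) :
    ∫⁻ x, h x ∂tilt μ m g k =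
      ∫⁻ x, ENNReal.ofReal (Real.exp (logDensity μ m g k x)) * h x ∂Measure.pi μ := by
  unfold tilt
  rw [lintegral_withDensity_eq_lintegral_mul _ (measurable_logDensity hg k).exp.ennreal_ofReal hh]
  rfl

/-- Tilting the coordinate `j` does not change the law of the coordinates before `j`. -/
lemma lintegral_tilt_succ (hm : ∀ j, 0 < m j) (hg : Measurable g) {C : ℝ}
    (hC : ∀ x, |g x| ≤ C) (j : Fin n) {h : (Fin n → ℝ) → ENNReal} (hh : Measurable h)
    (hupd : ∀ x y, h (Function.update x j y) = h x) :
    ∫⁻ x, h x ∂tilt μ m g (j + 1) = ∫⁻ x, h x ∂tilt μ m g j := by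
  rw [lintegral_tilt hg _ hh, lintegral_tilt hg _ hh, lintegral_pi_eq_lintegral_update μ
    (h := fun x => ENNReal.ofReal (Real.exp (logDensity μ m g (j + 1) x)) * h x)
    ((measurable_logDensity hg _).exp.ennreal_ofReal.mul hh) j]
  refine lintegral_congr fun x => ?_
  have e1 : ∀ y, logDensity μ m g j (Function.update x j y) = logDensity μ m g j x := fun y =>
    logDensity_congr μ m g fun i hi => Function.update_of_ne (by
      rintro rfl; exact lt_irrefl _ hi) _ _
  have e2 : ∀ y, value μ m g j.castSucc (Function.update x j y) = value μ m g j.castSucc x :=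
    fun y => value_congr μ m g fun i hi => Function.update_of_ne (by
      rintro rfl; exact lt_irrefl _ hi) _ _
  simp only [hupd, logDensity_succ, e1, e2, Real.exp_add]
  simp only [ENNReal.ofReal_mul (Real.exp_pos _).le, mul_assoc]
  rw [lintegral_mul_const, lintegral_exp_increment hm hg hC, one_mul]
  exact (((measurable_value_update hg _ j x).sub_const _).const_mul _).exp.ennreal_ofReal

lemma marginal_tilt_succ (hm : ∀ j, 0 < m j) (hg : Measurable g) {C : ℝ}
    (hC : ∀ x, |g x| ≤ C) (k : ℕ) (hk : k ≤ n) (j : Fin n) (hj : k ≤ j) :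
    marginal k hk (tilt μ m g (j + 1)) = marginal k hk (tilt μ m g j) := by
  unfold marginal
  refine Measure.ext_of_lintegral _ fun h hh => ?_
  rw [lintegral_map hh (measurable_take k hk), lintegral_map hh (measurable_take k hk)]
  refine lintegral_tilt_succ hm hg hC j (hh.comp (measurable_take k hk)) fun x y => ?_
  rw [Fin.take_update_of_ge (α := fun _ => ℝ) k hk x j hj y]

lemma marginal_tilt_of_le (hm : ∀ j, 0 < m j) (hg : Measurable g) {C : ℝ}
    (hC : ∀ x, |g x| ≤ C) {k k' : ℕ} (hkk' : k ≤ k') (hk' : k' ≤ n) :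
    marginal k (hkk'.trans hk') (tilt μ m g k') = marginal k (hkk'.trans hk') (tilt μ m g k) := by
  induction k', hkk' using Nat.le_induction with
  | base => rfl
  | succ j hj ih => exact (marginal_tilt_succ hm hg hC k _ ⟨j, hk'⟩ hj).trans (ih (by omega))

lemma map_withDensity_comp {α β : Type*} [MeasurableSpace α] [MeasurableSpace β] (ν : Measure α)
    {u : α → β} (hu : Measurable u) {h : β → ENNReal} (hh : Measurable h) :
    (ν.withDensity fun x => h (u x)).map u = (ν.map u).withDensity h := by
  ext A hA
  rw [Measure.map_apply hu hA, withDensity_apply _ (hu hA), withDensity_apply _ hA,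
    setLIntegral_map hA hh hu]

/-- Tilting later coordinates leaves the first k untouched, and what remains of the density is a
function of those k alone, so it passes through the projection. -/
lemma marginal_tilt (hm : ∀ j, 0 < m j) (hg : Measurable g) {C : ℝ}
    (hC : ∀ x, |g x| ≤ C) (k : ℕ) (hk : k ≤ n) :
    marginal k hk (tilt μ m g n) = (marginal k hk (Measure.pi μ)).withDensity fun z =>
      ENNReal.ofReal (Real.exp (logDensity μ m g k (pad k z))) := by
  rw [marginal_tilt_of_le hm hg hC hk le_rfl]
  unfold marginal
  rw [← map_withDensity_comp _ (measurable_take k hk)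
    (measurable_logDensity_pad hg k).exp.ennreal_ofReal]
  simp only [logDensity_pad_take]
  rfl

lemma isProbabilityMeasure_tilt (hm : ∀ j, 0 < m j) (hg : Measurable g) {C : ℝ}
    (hC : ∀ x, |g x| ≤ C) {k : ℕ} (hk : k ≤ n) : IsProbabilityMeasure (tilt μ m g k) := by
  have h : tilt μ m g 0 = Measure.pi μ := by simp [tilt, logDensity_zero]
  -- The marginal on zero coordinates records only the total mass, so the tilt has the mass of the
  -- untilted product.
  have h' := congrArg (fun ν => ν Set.univ) (marginal_tilt_of_le (μ := μ) hm hg hC k.zero_le hk)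
  simp only [marginal, h] at h'
  rw [Measure.map_apply (measurable_take 0 n.zero_le) .univ,
    Measure.map_apply (measurable_take 0 n.zero_le) .univ] at h'
  exact ⟨by simpa using h'⟩

lemma integral_exp_logDensity (hm : ∀ j, 0 < m j) (hg : Measurable g) {C : ℝ}
    (hC : ∀ x, |g x| ≤ C) {k : ℕ} (hk : k ≤ n) :
    ∫ x, Real.exp (logDensity μ m g k x) ∂Measure.pi μ = 1 := by
  have := isProbabilityMeasure_tilt (μ := μ) hm hg hC hk
  have h : (tilt μ m g k) Set.univ = 1 := measure_univ
  rw [tilt, withDensity_apply _ .univ, setLIntegral_univ] at h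
  rw [integral_eq_lintegral_of_nonneg_ae (Eventually.of_forall fun x => (Real.exp_pos _).le)
    (measurable_logDensity hg k).exp.aestronglyMeasurable, h, ENNReal.toReal_one]

lemma integral_tilt (hg : Measurable g) (k : ℕ) (F : (Fin n → ℝ) → ℝ) :
    ∫ x, F x ∂tilt μ m g k = ∫ x, Real.exp (logDensity μ m g k x) * F x ∂Measure.pi μ := by
  unfold tilt
  rw [integral_withDensity_eq_integral_toReal_smul
    (measurable_logDensity hg k).exp.ennreal_ofReal (Eventually.of_forall fun _ => by simp)]
  simp [ENNReal.toReal_ofReal (Real.exp_pos _).le]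

lemma isProbabilityMeasure_marginal (k : ℕ) (hk : k ≤ n) (ν : Measure (Fin n → ℝ))
    [IsProbabilityMeasure ν] : IsProbabilityMeasure (marginal k hk ν) :=
  Measure.isProbabilityMeasure_map (measurable_take k hk).aemeasurable

lemma integral_marginal (k : ℕ) (hk : k ≤ n) (ν : Measure (Fin n → ℝ)) {F : (Fin k → ℝ) → ℝ}
    (hF : Measurable F) : ∫ z, F z ∂marginal k hk ν = ∫ x, F (Fin.take k hk x) ∂ν :=
  integral_map (measurable_take k hk).aemeasurable hF.aestronglyMeasurable

lemma integral_exp_logDensity_pad (hm : ∀ j, 0 < m j) (hg : Measurable g) {C : ℝ}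
    (hC : ∀ x, |g x| ≤ C) {k : ℕ} (hk : k ≤ n) :
    ∫ z, Real.exp (logDensity μ m g k (pad k z)) ∂marginal k hk (Measure.pi μ) = 1 := by
  rw [integral_marginal k hk _ (measurable_logDensity_pad hg k).exp]
  simpa [logDensity_pad_take] using integral_exp_logDensity hm hg hC hk

/-- Gibbs' inequality on the first k coordinates; the next lemma is its equality case, attained by
the tilted measure at every k simultaneously. -/
lemma integral_logDensity_le (hm : ∀ j, 0 < m j) (hm1 : ∀ j, m j ≤ 1) (hg : Measurable g) {C : ℝ}
    (hC : ∀ x, |g x| ≤ C) (k : ℕ) (hk : k ≤ n) (ν : Measure (Fin n → ℝ)) [IsProbabilityMeasure ν]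
    (hfin : klDiv (marginal k hk ν) (marginal k hk (Measure.pi μ)) ≠ ⊤) :
    ∫ x, logDensity μ m g k x ∂ν ≤
      (klDiv (marginal k hk ν) (marginal k hk (Measure.pi μ))).toReal := by
  have := isProbabilityMeasure_marginal k hk ν
  have := isProbabilityMeasure_marginal k hk (Measure.pi μ)
  have h := (integral_le_toReal_klDiv (measurable_logDensity_pad hg k)
    (fun z => abs_logDensity_le hm hm1 hg hC k (pad k z))
    (integral_exp_logDensity_pad hm hg hC hk) hfin).1
  rw [integral_marginal k hk _ (measurable_logDensity_pad hg k)] at h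
  simpa [logDensity_pad_take] using h

lemma klDiv_marginal_tilt (hm : ∀ j, 0 < m j) (hm1 : ∀ j, m j ≤ 1) (hg : Measurable g) {C : ℝ}
    (hC : ∀ x, |g x| ≤ C) (k : ℕ) (hk : k ≤ n) :
    klDiv (marginal k hk (tilt μ m g n)) (marginal k hk (Measure.pi μ)) =
      ENNReal.ofReal (∫ x, logDensity μ m g k x ∂tilt μ m g n) ∧
    0 ≤ ∫ x, logDensity μ m g k x ∂tilt μ m g n := by
  have := isProbabilityMeasure_marginal k hk (Measure.pi μ)
  have h := klDiv_withDensity_exp (measurable_logDensity_pad hg k)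
    (fun z => abs_logDensity_le hm hm1 hg hC k (pad k z))
    (integral_exp_logDensity_pad (μ := μ) hm hg hC hk)
  rw [← marginal_tilt hm hg hC, integral_marginal k hk _ (measurable_logDensity_pad hg k)] at h
  simpa [logDensity_pad_take] using h

lemma marginal_self (k : ℕ) (h : k = n) (hk : k ≤ n) (ν ν' : Measure (Fin n → ℝ)) :
    klDiv (marginal k hk ν) (marginal k hk ν') = klDiv ν ν' := by
  subst h
  simp [marginal]

lemma tilted_eq_tilt (Φ : ℝ → ℝ) (φ f : (Fin n → ℝ) → ℝ) (p : ℝ × (Fin n → ℝ))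
    (hm : ∀ j, 0 < p.2 j) (hg : Measurable (terminal Φ φ f p.1)) {C : ℝ}
    (hC : ∀ x, |terminal Φ φ f p.1 x| ≤ C) :
    tilted Φ φ f μ p = tilt μ p.2 (terminal Φ φ f p.1) n := by
  unfold tilted tilt
  congr 1
  funext x
  congr 1
  unfold logDensity
  rw [Finset.filter_true_of_mem (fun j _ => j.isLt), Real.exp_sum]
  refine Finset.prod_congr rfl fun j _ => ?_
  have h := integral_exp_value (μ := μ) hm hg hC j x
  simp only [← take_succ_update]
  rw [mul_sub, Real.exp_sub, ← h]
  rfl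

end LogDensity

/-! ### Order parameters as Lagrange multipliers -/

section Slopes

variable {n : ℕ}

/-- The order parameter whose inverses have the decrements `c`: `1 / m_j = 1 + ∑_{i ≥ j} c_i`. -/
noncomputable def invTail (c : Fin n → ℝ) (j : Fin n) : ℝ := (1 + ∑ i ∈ Finset.Ici j, c i)⁻¹

variable {c : Fin n → ℝ}

lemma one_le_tail (hc : 0 ≤ c) (j : Fin n) : 1 ≤ 1 + ∑ i ∈ Finset.Ici j, c i :=
  le_add_of_nonneg_right (Finset.sum_nonneg fun i _ => hc i)

lemma invTail_pos (hc : 0 ≤ c) (j : Fin n) : 0 < invTail c j :=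
  inv_pos.2 (one_pos.trans_le (one_le_tail hc j))

lemma invTail_le_one (hc : 0 ≤ c) (j : Fin n) : invTail c j ≤ 1 :=
  inv_le_one_of_one_le₀ (one_le_tail hc j)

lemma invTail_mem_simplex (hc : 0 ≤ c) : invTail c ∈ simplex n := by
  refine ⟨fun j => ⟨invTail_pos hc j, invTail_le_one hc j⟩, fun i j hij => ?_⟩
  refine inv_anti₀ (one_pos.trans_le (one_le_tail hc j)) ?_
  exact add_le_add_right (Finset.sum_le_sum_of_subset_of_nonneg
    (Finset.Ici_subset_Ici.2 hij) fun k _ _ => hc k) 1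

/-- Take c_i = 1/m_i - 1/m_{i+1}: monotonicity of m and m_n ≤ 1 are exactly what makes these
nonnegative. -/
lemma exists_invTail_eq {m : Fin n → ℝ} (hm : m ∈ simplex n) : ∃ c, 0 ≤ c ∧ invTail c = m := by
  obtain ⟨h01, hmono⟩ := hm
  -- The default 1 plays the role of 1/m_{n+1}, so the last decrement is 1/m_n - 1.
  set s : ℕ → ℝ := fun i => if h : i < n then (m ⟨i, h⟩)⁻¹ else 1 with hs
  have hanti : ∀ i : Fin n, s (i + 1) ≤ s i := by
    intro i
    simp only [hs, i.isLt, dif_pos]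
    split_ifs with h
    · exact inv_anti₀ (h01 i).1 (hmono (Fin.le_def.2 (Nat.le_succ _)))
    · exact (one_le_inv₀ (h01 i).1).2 (h01 i).2
  refine ⟨fun i => s i - s (i + 1), fun i => sub_nonneg.2 (hanti i), ?_⟩
  funext j
  have h1 : ∑ i ∈ Finset.Ici j, (s i - s (i + 1)) =
      ∑ i ∈ Finset.Ico (j : ℕ) n, (s i - s (i + 1)) := by
    refine Finset.sum_bij (fun (i : Fin n) _ => (i : ℕ)) ?_ ?_ ?_ ?_
    · intro i hi; simpa using hi
    · intro i _ i' _ h; exact Fin.ext h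
    · intro i hi
      rw [Finset.mem_Ico] at hi
      exact ⟨⟨i, hi.2⟩, by simpa [Fin.le_def] using hi.1, rfl⟩
    · intro i _; rfl
  have h2 : ∑ i ∈ Finset.Ico (j : ℕ) n, (s i - s (i + 1)) = s j - s n := by
    rw [← neg_inj, ← Finset.sum_neg_distrib]
    simpa using Finset.sum_Ico_sub s j.isLt.le
  have h3 : s n = 1 := by simp [hs]
  have h4 : s j = (m j)⁻¹ := by simp [hs]
  rw [invTail, h1, h2, h3, h4]
  simp

/-- Summation by parts, obtained by exchanging the order of summation over j ≤ i. -/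
lemma sum_tail_mul (c a : Fin n → ℝ) :
    ∑ j, (1 + ∑ i ∈ Finset.Ici j, c i) * a j =
      ∑ j, a j + ∑ i, c i * ∑ j ∈ Finset.Iic i, a j := by
  simp only [add_mul, one_mul, Finset.sum_add_distrib, Finset.sum_mul, Finset.mul_sum]
  congr 1
  exact Finset.sum_comm' (by simp)

lemma continuousOn_invTail (j : Fin n) :
    ContinuousOn (fun c : Fin n → ℝ => invTail c j) (Set.Ici 0) := by
  unfold invTail
  exact ContinuousOn.inv₀ (by fun_prop) fun c hc => (one_pos.trans_le (one_le_tail hc j)).ne'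

end Slopes

/-! ### The pointwise decomposition and the envelope inequality -/

section Duality

variable {n : ℕ} {μ : Fin n → Measure ℝ} {c c' : Fin n → ℝ} {g g' : (Fin n → ℝ) → ℝ}

/-- The increments P_j - P_{j-1} telescope to g - P_0. Writing each as 1/m_j times its contribution
to the log-density and summing by parts groups them into log-densities of marginals. -/
lemma eq_value_zero_add (hc : 0 ≤ c) (x : Fin n → ℝ) :
    g x = value μ (invTail c) g 0 x + logDensity μ (invTail c) g n x +
      ∑ i : Fin n, c i * logDensity μ (invTail c) g (i + 1) x := by
  set v := value μ (invTail c) g with hv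
  have h1 : ∑ j : Fin n, (v j.succ x - v j.castSucc x) = g x - v 0 x := by
    have := Fin.sum_univ_succ fun j : Fin (n + 1) => v j x
    have h' := Fin.sum_univ_castSucc fun j : Fin (n + 1) => v j x
    rw [Finset.sum_sub_distrib]
    have h'' : v (Fin.last n) x = g x := value_last μ _ g x
    linarith
  have h2 := sum_tail_mul c fun j => invTail c j * (v j.succ x - v j.castSucc x)
  have h3 : ∀ j, (1 + ∑ i ∈ Finset.Ici j, c i) * (invTail c j * (v j.succ x - v j.castSucc x)) =
      v j.succ x - v j.castSucc x := fun j => by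
    rw [← mul_assoc, invTail, mul_inv_cancel₀ (one_pos.trans_le (one_le_tail hc j)).ne', one_mul]
  simp only [h3, h1] at h2
  have h4 : logDensity μ (invTail c) g n x =
      ∑ j, invTail c j * (v j.succ x - v j.castSucc x) := by
    rw [logDensity, Finset.filter_true_of_mem (fun j _ => j.isLt)]
  have h5 : ∀ i : Fin n, logDensity μ (invTail c) g (i + 1) x =
      ∑ j ∈ Finset.Iic i, invTail c j * (v j.succ x - v j.castSucc x) := fun i => by
    refine Finset.sum_congr ?_ fun _ _ => rfl
    ext j
    simp only [Finset.mem_filter, Finset.mem_univ, true_and, Finset.mem_Iic, Fin.le_def,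
      Nat.lt_succ_iff]
  simp only [h4, h5]
  linarith

variable [∀ k, IsProbabilityMeasure (μ k)]

lemma integral_eq_level_zero_add (hc : 0 ≤ c) (hg : Measurable g) {C : ℝ} (hC : ∀ x, |g x| ≤ C)
    (ν : Measure (Fin n → ℝ)) [IsProbabilityMeasure ν] :
    ∫ x, g x ∂ν = level μ (invTail c) g 0 (fun i : Fin 0 => i.elim0) +
      ∫ x, logDensity μ (invTail c) g n x ∂ν +
      ∑ i : Fin n, c i * ∫ x, logDensity μ (invTail c) g (i + 1) x ∂ν := by
  have hint : ∀ k, Integrable (logDensity μ (invTail c) g k) ν := fun k =>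
    integrable_of_abs_le (measurable_logDensity hg k)
      (abs_logDensity_le (invTail_pos hc) (invTail_le_one hc) hg hC k)
  rw [integral_congr_ae (Eventually.of_forall fun x => eq_value_zero_add (μ := μ) hc x)]
  simp only [value_zero]
  generalize level μ (invTail c) g 0 (fun i : Fin 0 => i.elim0) = P₀
  have h1 : Integrable (fun x => P₀ + logDensity μ (invTail c) g n x) ν :=
    (integrable_const _).add (hint n)
  have h2 : ∀ i ∈ Finset.univ, Integrable
      (fun x => c i * logDensity μ (invTail c) g ((i : ℕ) + 1) x) ν :=
    fun i _ => (hint _).const_mul _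
  rw [integral_add h1 (integrable_finsetSum _ h2), integral_add (integrable_const _) (hint n),
    integral_finsetSum _ h2]
  simp [integral_const_mul]

/-- The relative entropy of the first `k` coordinates of the tilted measure. -/
noncomputable def tiltEntropy (μ : Fin n → Measure ℝ) (c : Fin n → ℝ) (g : (Fin n → ℝ) → ℝ)
    (k : ℕ) : ℝ :=
  ∫ x, logDensity μ (invTail c) g k x ∂tilt μ (invTail c) g n

/-- The tilted measure for (c', g') is optimal in the variational formula for its own P_0 and merely
a competitor in the one for (c, g). -/
lemma level_zero_sub_le (hc : 0 ≤ c) (hc' : 0 ≤ c') (hg : Measurable g) (hg' : Measurable g')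
    {C : ℝ} (hC : ∀ x, |g x| ≤ C) (hC' : ∀ x, |g' x| ≤ C) :
    level μ (invTail c') g' 0 (fun i : Fin 0 => i.elim0) -
        level μ (invTail c) g 0 (fun i : Fin 0 => i.elim0) ≤
      ∫ x, g' x ∂tilt μ (invTail c') g' n - ∫ x, g x ∂tilt μ (invTail c') g' n -
        ∑ i : Fin n, (c' i - c i) * tiltEntropy μ c' g' (i + 1) := by
  have := isProbabilityMeasure_tilt (μ := μ) (invTail_pos hc') hg' hC' le_rfl
  have e' := integral_eq_level_zero_add (μ := μ) hc' hg' hC' (tilt μ (invTail c') g' n)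
  have e := integral_eq_level_zero_add (μ := μ) hc hg hC (tilt μ (invTail c') g' n)
  have h : ∀ k ≤ n, ∫ x, logDensity μ (invTail c) g k x ∂tilt μ (invTail c') g' n ≤
      tiltEntropy μ c' g' k := by
    intro k hk
    obtain ⟨h1, h2⟩ :=
      klDiv_marginal_tilt (μ := μ) (invTail_pos hc') (invTail_le_one hc') hg' hC' k hk
    have := integral_logDensity_le (μ := μ) (invTail_pos hc) (invTail_le_one hc) hg hC k hk
      (tilt μ (invTail c') g' n) (by rw [h1]; exact ENNReal.ofReal_ne_top)
    rwa [h1, ENNReal.toReal_ofReal h2] at this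
  have hs : ∑ i : Fin n, c i * ∫ x, logDensity μ (invTail c) g (i + 1) x
        ∂tilt μ (invTail c') g' n ≤ ∑ i : Fin n, c i * tiltEntropy μ c' g' (i + 1) :=
    Finset.sum_le_sum fun i _ => mul_le_mul_of_nonneg_left (h _ i.isLt) (hc i)
  have hn := h n le_rfl
  simp only [sub_mul, Finset.sum_sub_distrib]
  unfold tiltEntropy at *
  linarith

end Duality

/-! ### Continuity of tilted integrals in the parameters -/

section Continuity

variable {n : ℕ} {μ : Fin n → Measure ℝ} [∀ k, IsProbabilityMeasure (μ k)]
variable {ι : Type*} {l : Filter ι} [l.IsCountablyGenerated]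
  {m : Fin n → ℝ} {g : (Fin n → ℝ) → ℝ} {m' : ι → Fin n → ℝ} {g' : ι → (Fin n → ℝ) → ℝ} {C : ℝ}

lemma tendsto_logDensity
    (hm : ∀ j, 0 < m j) (hg : Measurable g) (hC : ∀ x, |g x| ≤ C)
    (hm' : ∀ᶠ i in l, ∀ j, 0 < m' i j) (hg' : ∀ i, Measurable (g' i))
    (hC' : ∀ᶠ i in l, ∀ x, |g' i x| ≤ C) (hlim : ∀ j, Tendsto (fun i => m' i j) l (𝓝 (m j)))
    (hlimg : ∀ x, Tendsto (fun i => g' i x) l (𝓝 (g x))) (k : ℕ) (x : Fin n → ℝ) :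
    Tendsto (fun i => logDensity μ (m' i) (g' i) k x) l (𝓝 (logDensity μ m g k x)) :=
  tendsto_finsetSum _ fun j _ => (hlim j).mul
    ((tendsto_value hm hg hC hm' hg' hC' hlim hlimg _ x).sub
      (tendsto_value hm hg hC hm' hg' hC' hlim hlimg _ x))

lemma tendsto_integral_tilt
    (hm : ∀ j, 0 < m j) (hg : Measurable g) (hC : ∀ x, |g x| ≤ C)
    (hm' : ∀ᶠ i in l, ∀ j, 0 < m' i j) (hm1 : ∀ᶠ i in l, ∀ j, m' i j ≤ 1)
    (hg' : ∀ i, Measurable (g' i))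
    (hC' : ∀ᶠ i in l, ∀ x, |g' i x| ≤ C) (hlim : ∀ j, Tendsto (fun i => m' i j) l (𝓝 (m j)))
    (hlimg : ∀ x, Tendsto (fun i => g' i x) l (𝓝 (g x)))
    {F : (Fin n → ℝ) → ℝ} {F' : ι → (Fin n → ℝ) → ℝ} {B : ℝ} (hF' : ∀ i, Measurable (F' i))
    (hB : ∀ᶠ i in l, ∀ x, |F' i x| ≤ B) (hlimF : ∀ x, Tendsto (fun i => F' i x) l (𝓝 (F x))) :
    Tendsto (fun i => ∫ x, F' i x ∂tilt μ (m' i) (g' i) n) l (𝓝 (∫ x, F x ∂tilt μ m g n)) := by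
  simp only [integral_tilt hg n, integral_tilt (hg' _) n]
  refine tendsto_integral_filter_of_dominated_convergence
    (fun _ => Real.exp (n * (C + C)) * B) ?_ ?_ (integrable_const _) ?_
  · exact Eventually.of_forall fun i =>
      ((measurable_logDensity (hg' i) n).exp.mul (hF' i)).aestronglyMeasurable
  · filter_upwards [hm', hm1, hC', hB] with i h1 h2 h3 h4
    refine Eventually.of_forall fun x => ?_
    rw [Real.norm_eq_abs, abs_mul, Real.abs_exp]
    have := (abs_le.1 (abs_logDensity_le (μ := μ) h1 h2 (hg' i) h3 n x)).2
    exact mul_le_mul (Real.exp_le_exp.2 this) (h4 x) (abs_nonneg _) (Real.exp_pos _).le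
  · exact Eventually.of_forall fun x => ((Real.continuous_exp.tendsto _).comp
      (tendsto_logDensity hm hg hC hm' hg' hC' hlim hlimg n x)).mul (hlimF x)

end Continuity

/-! ### Concavity of Φ on the range interval -/

section Tangent

variable {Φ : ℝ → ℝ} {a b : ℝ}

lemma strictAntiOn_deriv_of_deriv_deriv_neg (hΦ' : Differentiable ℝ (deriv Φ))
    (hΦ'' : ∀ q ∈ Set.Icc a b, deriv (deriv Φ) q < 0) : StrictAntiOn (deriv Φ) (Set.Icc a b) :=
  strictAntiOn_of_deriv_neg (convex_Icc a b) hΦ'.continuous.continuousOn fun q hq =>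
    hΦ'' q (interior_subset hq)

/-- By the mean value theorem on each side of q, only monotonicity of Φ' between q and t matters. -/
lemma le_tangent (hΦ : Differentiable ℝ Φ) (hanti : StrictAntiOn (deriv Φ) (Set.Icc a b)) {q t : ℝ}
    (hq : q ∈ Set.Icc a b) (ht : t ∈ Set.Icc a b) : Φ t ≤ Φ q + deriv Φ q * (t - q) := by
  rcases lt_trichotomy q t with h | rfl | h
  · obtain ⟨ξ, hξ, e⟩ := exists_deriv_eq_slope Φ h hΦ.continuous.continuousOn
      hΦ.differentiableOn
    have hle := (hanti hq ⟨hq.1.trans hξ.1.le, hξ.2.le.trans ht.2⟩ hξ.1).le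
    rw [e, div_le_iff₀ (sub_pos.2 h)] at hle
    linarith
  · simp
  · obtain ⟨ξ, hξ, e⟩ := exists_deriv_eq_slope Φ h hΦ.continuous.continuousOn
      hΦ.differentiableOn
    have hle := (hanti ⟨ht.1.trans hξ.1.le, hξ.2.le.trans hq.2⟩ hq hξ.2).le
    rw [e, le_div_iff₀ (sub_pos.2 h)] at hle
    linarith

end Tangent

/-! ### The Parisi function in the multipliers: continuity and existence of a minimum -/

section Parisi

variable {n : ℕ} {μ : Fin n → Measure ℝ} {Θ : ℝ} {γ : Fin n → ℝ} {Φ : ℝ → ℝ}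
  {φ f : (Fin n → ℝ) → ℝ}

lemma measurable_terminal (hφ : Measurable φ) (hf : Measurable f) (q : ℝ) :
    Measurable (terminal Φ φ f q) :=
  (hφ.const_mul _).add hf

lemma exists_abs_terminal_le (hΦ' : Differentiable ℝ (deriv Φ)) (hφ_bdd : ∃ C, ∀ x, |φ x| ≤ C)
    (hf_bdd : ∃ C, ∀ x, |f x| ≤ C) {Q : Set ℝ} (hQ : IsCompact Q) :
    ∃ C, ∀ q ∈ Q, ∀ x, |terminal Φ φ f q x| ≤ C := by
  obtain ⟨A, hA⟩ := hφ_bdd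
  obtain ⟨B, hB⟩ := hf_bdd
  obtain ⟨D, hD⟩ := hQ.exists_bound_of_continuousOn hΦ'.continuous.continuousOn
  refine ⟨D * A + B, fun q hq x => (abs_add_le _ _).trans (add_le_add ?_ (hB x))⟩
  rw [abs_mul]
  exact mul_le_mul (hD q hq) (hA x) (abs_nonneg _) ((norm_nonneg _).trans (hD q hq))

lemma integral_mem_Icc (hφ : Measurable φ) (hφ_bdd : ∃ C, ∀ x, |φ x| ≤ C)
    (ν : Measure (Fin n → ℝ)) [IsProbabilityMeasure ν] :
    ∫ x, φ x ∂ν ∈ Set.Icc (⨅ x, φ x) (⨆ x, φ x) := by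
  obtain ⟨A, hA⟩ := hφ_bdd
  have hint : Integrable φ ν := integrable_of_abs_le hφ hA
  have hbelow : BddBelow (Set.range φ) := ⟨-A, by rintro _ ⟨x, rfl⟩; exact (abs_le.1 (hA x)).1⟩
  have habove : BddAbove (Set.range φ) := ⟨A, by rintro _ ⟨x, rfl⟩; exact (abs_le.1 (hA x)).2⟩
  have h1 := integral_mono (μ := ν) (integrable_const _) hint fun x => ciInf_le hbelow x
  have h2 := integral_mono (μ := ν) hint (integrable_const _) fun x => le_ciSup habove x
  simp only [integral_const, probReal_univ, one_smul] at h1 h2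
  exact ⟨h1, h2⟩

/-- The entropy budget of the first coordinates up to `k`. -/
noncomputable def budget (Θ : ℝ) (γ : Fin n → ℝ) (k : Fin n) : ℝ :=
  Θ * Real.log 2 * ∑ j ∈ Finset.Iic k, γ j

lemma budget_pos (hΘ : 0 < Θ) (hγ : ∀ k, 0 < γ k) (k : Fin n) : 0 < budget Θ γ k :=
  mul_pos (mul_pos hΘ (Real.log_pos one_lt_two))
    (Finset.sum_pos (fun j _ => hγ j) ⟨k, by simp⟩)

/-- Summation by parts turns ∑ γ_k Θ log 2 / m_k into Θ log 2 + ∑ c_i budget_i; the normalization of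
γ cancels the final -Θ log 2. -/
lemma parisi_invTail (hγ_sum : ∑ k, γ k = 1) (q : ℝ) (c : Fin n → ℝ) :
    parisi Θ γ Φ φ f μ (q, invTail c) = Φ q - q * deriv Φ q +
      level μ (invTail c) (terminal Φ φ f q) 0 (fun i : Fin 0 => i.elim0) +
        ∑ i, c i * budget Θ γ i := by
  have h := sum_tail_mul c fun j => γ j * Θ * Real.log 2
  have h1 : ∑ j, γ j * Θ * Real.log 2 = Θ * Real.log 2 := by
    rw [← Finset.sum_mul, ← Finset.sum_mul, hγ_sum, one_mul]
  have h2 : ∑ k, γ k * Θ * Real.log 2 / invTail c k =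
      ∑ j, (1 + ∑ i ∈ Finset.Ici j, c i) * (γ j * Θ * Real.log 2) :=
    Finset.sum_congr rfl fun k _ => by rw [invTail, div_inv_eq_mul, mul_comm]
  have h3 : ∀ i, ∑ j ∈ Finset.Iic i, γ j * Θ * Real.log 2 = budget Θ γ i := fun i => by
    rw [budget, ← Finset.sum_mul, ← Finset.sum_mul]; ring
  simp only [parisi, h2, h, h1, h3]
  ring

variable [∀ k, IsProbabilityMeasure (μ k)]

section ParameterContinuity

variable {Q : Set ℝ} {C : ℝ}

lemma tendsto_terminal (hΦ' : Differentiable ℝ (deriv Φ)) {s : Set (ℝ × (Fin n → ℝ))}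
    (p : ℝ × (Fin n → ℝ)) (x : Fin n → ℝ) :
    Tendsto (fun p' : ℝ × (Fin n → ℝ) => terminal Φ φ f p'.1 x) (𝓝[s] p)
      (𝓝 (terminal Φ φ f p.1 x)) := by
  have h : Continuous fun p' : ℝ × (Fin n → ℝ) => deriv Φ p'.1 * φ x + f x :=
    ((hΦ'.continuous.comp continuous_fst).mul_const _).add_const _
  exact h.continuousAt.continuousWithinAt

lemma tendsto_invTail {p : ℝ × (Fin n → ℝ)} (hp : p ∈ Q ×ˢ Set.Ici (0 : Fin n → ℝ)) (j : Fin n) :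
    Tendsto (fun p' : ℝ × (Fin n → ℝ) => invTail p'.2 j) (𝓝[Q ×ˢ Set.Ici 0] p)
      (𝓝 (invTail p.2 j)) :=
  ((continuousOn_invTail j).comp continuousOn_snd fun _ hp' => hp'.2) p hp

lemma continuousOn_level_zero (hφ : Measurable φ) (hf : Measurable f)
    (hΦ' : Differentiable ℝ (deriv Φ)) (hC : ∀ q ∈ Q, ∀ x, |terminal Φ φ f q x| ≤ C) :
    ContinuousOn (fun p : ℝ × (Fin n → ℝ) => level μ (invTail p.2) (terminal Φ φ f p.1) 0
      (fun i : Fin 0 => i.elim0)) (Q ×ˢ Set.Ici 0) := by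
  intro p hp
  have h := tendsto_value (μ := μ) (l := 𝓝[Q ×ˢ Set.Ici 0] p) (m' := fun p' => invTail p'.2)
    (g' := fun p' => terminal Φ φ f p'.1) (invTail_pos hp.2)
    (measurable_terminal hφ hf p.1) (hC p.1 hp.1)
    (eventually_mem_nhdsWithin.mono fun p' hp' => invTail_pos hp'.2)
    (fun p' => measurable_terminal hφ hf p'.1)
    (eventually_mem_nhdsWithin.mono fun p' hp' => hC p'.1 hp'.1)
    (tendsto_invTail hp) (tendsto_terminal hΦ' p) 0 0
  simp only [value_zero] at h
  exact h

lemma continuousWithinAt_integral_tilt (hφ : Measurable φ) (hf : Measurable f)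
    (hΦ' : Differentiable ℝ (deriv Φ)) (hC : ∀ q ∈ Q, ∀ x, |terminal Φ φ f q x| ≤ C)
    {p : ℝ × (Fin n → ℝ)} (hp : p ∈ Q ×ˢ Set.Ici (0 : Fin n → ℝ))
    {F : ℝ × (Fin n → ℝ) → (Fin n → ℝ) → ℝ} {B : ℝ} (hF : ∀ p', Measurable (F p'))
    (hB : ∀ p' ∈ Q ×ˢ Set.Ici (0 : Fin n → ℝ), ∀ x, |F p' x| ≤ B)
    (hlimF : ∀ x, Tendsto (fun p' => F p' x) (𝓝[Q ×ˢ Set.Ici 0] p) (𝓝 (F p x))) :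
    ContinuousWithinAt (fun p' => ∫ x, F p' x ∂tilt μ (invTail p'.2) (terminal Φ φ f p'.1) n)
      (Q ×ˢ Set.Ici 0) p := by
  have hev : ∀ᶠ p' in 𝓝[Q ×ˢ Set.Ici (0 : Fin n → ℝ)] p, p' ∈ Q ×ˢ Set.Ici (0 : Fin n → ℝ) :=
    eventually_mem_nhdsWithin
  have h0 : ∀ᶠ p' : ℝ × (Fin n → ℝ) in 𝓝[Q ×ˢ Set.Ici 0] p, ∀ j, 0 < invTail p'.2 j :=
    hev.mono fun p' hp' => invTail_pos hp'.2
  have h1 : ∀ᶠ p' : ℝ × (Fin n → ℝ) in 𝓝[Q ×ˢ Set.Ici 0] p, ∀ j, invTail p'.2 j ≤ 1 :=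
    hev.mono fun p' hp' => invTail_le_one hp'.2
  have h2 : ∀ᶠ p' : ℝ × (Fin n → ℝ) in 𝓝[Q ×ˢ Set.Ici 0] p,
      ∀ x, |terminal Φ φ f p'.1 x| ≤ C := hev.mono fun p' hp' => hC p'.1 hp'.1
  exact tendsto_integral_tilt (invTail_pos hp.2) (measurable_terminal hφ hf p.1) (hC p.1 hp.1)
    h0 h1 (fun p' => measurable_terminal hφ hf p'.1) h2 (tendsto_invTail hp)
    (tendsto_terminal hΦ' p) hF (hev.mono hB) hlimF

lemma continuousOn_tiltEntropy (hφ : Measurable φ) (hf : Measurable f)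
    (hΦ' : Differentiable ℝ (deriv Φ)) (hC : ∀ q ∈ Q, ∀ x, |terminal Φ φ f q x| ≤ C) (k : ℕ) :
    ContinuousOn (fun p : ℝ × (Fin n → ℝ) => tiltEntropy μ p.2 (terminal Φ φ f p.1) k)
      (Q ×ˢ Set.Ici 0) := by
  intro p hp
  have hev : ∀ᶠ p' in 𝓝[Q ×ˢ Set.Ici (0 : Fin n → ℝ)] p, p' ∈ Q ×ˢ Set.Ici (0 : Fin n → ℝ) :=
    eventually_mem_nhdsWithin
  have h0 : ∀ᶠ p' : ℝ × (Fin n → ℝ) in 𝓝[Q ×ˢ Set.Ici 0] p, ∀ j, 0 < invTail p'.2 j :=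
    hev.mono fun p' hp' => invTail_pos hp'.2
  have h2 : ∀ᶠ p' : ℝ × (Fin n → ℝ) in 𝓝[Q ×ˢ Set.Ici 0] p,
      ∀ x, |terminal Φ φ f p'.1 x| ≤ C := hev.mono fun p' hp' => hC p'.1 hp'.1
  refine continuousWithinAt_integral_tilt hφ hf hΦ' hC hp
    (F := fun p' => logDensity μ (invTail p'.2) (terminal Φ φ f p'.1) k) (B := n * (C + C))
    (fun p' => measurable_logDensity (measurable_terminal hφ hf p'.1) k) ?_ ?_
  · intro p' hp' x
    exact abs_logDensity_le (invTail_pos hp'.2) (invTail_le_one hp'.2)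
      (measurable_terminal hφ hf p'.1) (hC p'.1 hp'.1) k x
  · intro x
    exact tendsto_logDensity (invTail_pos hp.2) (measurable_terminal hφ hf p.1) (hC p.1 hp.1)
      h0 (fun p' => measurable_terminal hφ hf p'.1) h2 (tendsto_invTail hp)
      (tendsto_terminal hΦ' p) k x

lemma continuousOn_overlap (hφ : Measurable φ) (hf : Measurable f)
    (hφ_bdd : ∃ C, ∀ x, |φ x| ≤ C)
    (hΦ' : Differentiable ℝ (deriv Φ)) (hC : ∀ q ∈ Q, ∀ x, |terminal Φ φ f q x| ≤ C) :
    ContinuousOn (fun p : ℝ × (Fin n → ℝ) =>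
      ∫ x, φ x ∂tilt μ (invTail p.2) (terminal Φ φ f p.1) n) (Q ×ˢ Set.Ici 0) := fun _ hp =>
  let ⟨_, hA⟩ := hφ_bdd
  continuousWithinAt_integral_tilt hφ hf hΦ' hC hp (fun _ => hφ) (fun _ _ => hA)
    fun _ => tendsto_const_nhds

lemma continuousOn_parisi (hγ_sum : ∑ k, γ k = 1) (hφ : Measurable φ) (hf : Measurable f)
    (hΦ : Differentiable ℝ Φ) (hΦ' : Differentiable ℝ (deriv Φ))
    (hC : ∀ q ∈ Q, ∀ x, |terminal Φ φ f q x| ≤ C) :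
    ContinuousOn (fun p : ℝ × (Fin n → ℝ) => parisi Θ γ Φ φ f μ (p.1, invTail p.2))
      (Q ×ˢ Set.Ici 0) := by
  simp only [parisi_invTail hγ_sum]
  have h1 : Continuous fun p : ℝ × (Fin n → ℝ) => Φ p.1 - p.1 * deriv Φ p.1 :=
    (hΦ.continuous.comp continuous_fst).sub
      (continuous_fst.mul (hΦ'.continuous.comp continuous_fst))
  exact (h1.continuousOn.add (continuousOn_level_zero hφ hf hΦ' hC)).add
    (Continuous.continuousOn (by fun_prop))

end ParameterContinuity

/-- P_0 and the Φ terms are bounded uniformly in c, while every multiplier is paired with a positive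
budget; so P is coercive and a compact box suffices. -/
lemma exists_isMinOn_parisi (hΘ : 0 < Θ) (hγ : ∀ k, 0 < γ k) (hγ_sum : ∑ k, γ k = 1)
    (hφ : Measurable φ) (hf : Measurable f) (hΦ : Differentiable ℝ Φ)
    (hΦ' : Differentiable ℝ (deriv Φ)) {Q : Set ℝ} (hQ : IsCompact Q) (hQ0 : Q.Nonempty) {C : ℝ}
    (hC : ∀ q ∈ Q, ∀ x, |terminal Φ φ f q x| ≤ C) :
    ∃ p ∈ Q ×ˢ Set.Ici (0 : Fin n → ℝ),
      IsMinOn (fun p => parisi Θ γ Φ φ f μ (p.1, invTail p.2)) (Q ×ˢ Set.Ici 0) p := by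
  set F : ℝ × (Fin n → ℝ) → ℝ := fun p => parisi Θ γ Φ φ f μ (p.1, invTail p.2) with hF
  have hcont : ContinuousOn F (Q ×ˢ Set.Ici 0) := continuousOn_parisi hγ_sum hφ hf hΦ hΦ' hC
  obtain ⟨D, hD⟩ := hQ.exists_bound_of_continuousOn
    (f := fun q => Φ q - q * deriv Φ q)
    (hΦ.continuous.sub (continuous_id.mul hΦ'.continuous)).continuousOn
  have hlow : ∀ p ∈ Q ×ˢ Set.Ici (0 : Fin n → ℝ), ∀ k,
      p.2 k * budget Θ γ k - D - C ≤ F p := by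
    intro p hp k
    have h1 := (abs_le.1 (hD p.1 hp.1)).1
    have h2 := (abs_le.1 (abs_value_le (μ := μ) (invTail_pos hp.2)
      (measurable_terminal hφ hf p.1) (hC p.1 hp.1) 0 0)).1
    have h3 : p.2 k * budget Θ γ k ≤ ∑ i, p.2 i * budget Θ γ i :=
      Finset.single_le_sum (f := fun i => p.2 i * budget Θ γ i)
        (fun i _ => mul_nonneg (hp.2 i) (budget_pos hΘ hγ i).le) (Finset.mem_univ k)
    rw [value_zero] at h2
    simp only [hF, parisi_invTail hγ_sum]
    linarith
  obtain ⟨q₀, hq₀⟩ := hQ0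
  set p₀ : ℝ × (Fin n → ℝ) := (q₀, 0) with hp₀
  -- Beyond `R k` in coordinate k, the lower bound `hlow` already exceeds the value at c = 0.
  set R : Fin n → ℝ := fun k => |(F p₀ + D + C) / budget Θ γ k| with hR
  have hR0 : 0 ≤ R := fun k => abs_nonneg _
  have hsub : Q ×ˢ Set.Icc 0 R ⊆ Q ×ˢ Set.Ici (0 : Fin n → ℝ) :=
    Set.prod_mono le_rfl Set.Icc_subset_Ici_self
  have hp₀mem : p₀ ∈ Q ×ˢ Set.Icc 0 R := ⟨hq₀, le_rfl, hR0⟩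
  obtain ⟨p, hp, hmin⟩ := (hQ.prod isCompact_Icc).exists_isMinOn ⟨p₀, hp₀mem⟩ (hcont.mono hsub)
  refine ⟨p, hsub hp, fun p' hp' => ?_⟩
  by_cases h : p'.2 ≤ R
  · exact hmin ⟨hp'.1, hp'.2, h⟩
  · obtain ⟨k, hk⟩ : ∃ k, R k < p'.2 k := by simpa [Pi.le_def] using h
    have hb := budget_pos hΘ hγ k
    have h1 := (le_abs_self _).trans_lt hk
    rw [div_lt_iff₀ hb] at h1
    have h2 := hlow p' hp' k
    exact (hmin hp₀mem).trans (by linarith : F p₀ ≤ F p')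

end Parisi

/-! ### Weak duality and increments of the Parisi function -/

section Gibbs

variable {n : ℕ} {μ : Fin n → Measure ℝ}
  {Θ : ℝ} {γ : Fin n → ℝ} {Φ : ℝ → ℝ} {φ f : (Fin n → ℝ) → ℝ} {C : ℝ}

lemma integral_terminal (hφ : Measurable φ) (hf : Measurable f) (hφ_bdd : ∃ C, ∀ x, |φ x| ≤ C)
    (hf_bdd : ∃ C, ∀ x, |f x| ≤ C) (q : ℝ) (ν : Measure (Fin n → ℝ)) [IsProbabilityMeasure ν] :
    ∫ x, terminal Φ φ f q x ∂ν = deriv Φ q * ∫ x, φ x ∂ν + ∫ x, f x ∂ν := by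
  obtain ⟨A, hA⟩ := hφ_bdd
  obtain ⟨B, hB⟩ := hf_bdd
  unfold terminal
  rw [integral_add ((integrable_of_abs_le hφ hA).const_mul _) (integrable_of_abs_le hf hB),
    integral_const_mul]

lemma klDiv_ne_top_of_mem_admissible (hn : 0 < n) {ν : Measure (Fin n → ℝ)}
    (hν : ν ∈ admissible Θ γ μ) : klDiv ν (Measure.pi μ) ≠ ⊤ := by
  -- The constraint with index n - 1 concerns all n coordinates, hence the full relative entropy.
  have h := ne_top_of_le_ne_top ENNReal.ofReal_ne_top (hν.2 ⟨n - 1, by omega⟩)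
  rwa [marginal_self _ (by simp only; omega)] at h

variable [∀ k, IsProbabilityMeasure (μ k)]

/-- Weak duality, with the loss caused by the relative entropy to the tilted measure. -/
lemma gibbs_le_parisi_add (hΘ : 0 < Θ) (hγ : ∀ k, 0 < γ k) (hγ_sum : ∑ k, γ k = 1)
    (hφ : Measurable φ) (hf : Measurable f) (hφ_bdd : ∃ C, ∀ x, |φ x| ≤ C)
    (hf_bdd : ∃ C, ∀ x, |f x| ≤ C) (hΦ : Differentiable ℝ Φ)
    (hanti : StrictAntiOn (deriv Φ) (Set.Icc (⨅ x, φ x) (⨆ x, φ x)))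
    {q : ℝ} (hq : q ∈ Set.Icc (⨅ x, φ x) (⨆ x, φ x)) (hC : ∀ x, |terminal Φ φ f q x| ≤ C)
    {c : Fin n → ℝ} (hc : 0 ≤ c) {ν : Measure (Fin n → ℝ)} (hν : ν ∈ admissible Θ γ μ) :
    gibbs Φ φ f μ ν ≤ parisi Θ γ Φ φ f μ (q, invTail c) +
      (∫ x, logDensity μ (invTail c) (terminal Φ φ f q) n x ∂ν -
        (klDiv ν (Measure.pi μ)).toReal) := by
  have := hν.1
  have hg := measurable_terminal (Φ := Φ) hφ hf q
  have h1 := le_tangent hΦ hanti hq (integral_mem_Icc hφ hφ_bdd ν)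
  have h2 := integral_terminal (Φ := Φ) hφ hf hφ_bdd hf_bdd q ν
  have h3 := integral_eq_level_zero_add (μ := μ) hc hg hC ν
  have h4 : ∑ i : Fin n, c i * ∫ x, logDensity μ (invTail c) (terminal Φ φ f q) (i + 1) x ∂ν ≤
      ∑ i, c i * budget Θ γ i := by
    refine Finset.sum_le_sum fun i _ => mul_le_mul_of_nonneg_left ?_ (hc i)
    have hi := hν.2 i
    refine (integral_logDensity_le (invTail_pos hc) (invTail_le_one hc) hg hC (i + 1) i.isLt ν
      (ne_top_of_le_ne_top ENNReal.ofReal_ne_top hi)).trans ?_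
    exact ENNReal.toReal_le_of_le_ofReal (budget_pos hΘ hγ i).le hi
  rw [parisi_invTail hγ_sum]
  unfold gibbs
  linarith

/-- The envelope inequality together with the tangent bound at q. The right side involves the tilted
measure at the endpoint (q', c'), so its continuity replaces differentiability of P. -/
lemma parisi_sub_le (hγ_sum : ∑ k, γ k = 1)
    (hφ : Measurable φ) (hf : Measurable f) (hφ_bdd : ∃ C, ∀ x, |φ x| ≤ C)
    (hf_bdd : ∃ C, ∀ x, |f x| ≤ C) {Q : Set ℝ}
    (htan : ∀ q ∈ Q, ∀ t ∈ Q, Φ t ≤ Φ q + deriv Φ q * (t - q))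
    (hC : ∀ q ∈ Q, ∀ x, |terminal Φ φ f q x| ≤ C)
    {q q' : ℝ} (hq : q ∈ Q) (hq' : q' ∈ Q) {c c' : Fin n → ℝ} (hc : 0 ≤ c) (hc' : 0 ≤ c') :
    parisi Θ γ Φ φ f μ (q', invTail c') - parisi Θ γ Φ φ f μ (q, invTail c) ≤
      (deriv Φ q - deriv Φ q') *
          (q' - ∫ x, φ x ∂tilt μ (invTail c') (terminal Φ φ f q') n) +
        ∑ i : Fin n, (c' i - c i) *
          (budget Θ γ i - tiltEntropy μ c' (terminal Φ φ f q') (i + 1)) := by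
  have hg := measurable_terminal (Φ := Φ) hφ hf q
  have hg' := measurable_terminal (Φ := Φ) hφ hf q'
  have := isProbabilityMeasure_tilt (μ := μ) (invTail_pos hc') hg' (hC q' hq') le_rfl
  have h1 := level_zero_sub_le (μ := μ) hc hc' hg hg' (hC q hq) (hC q' hq')
  rw [integral_terminal hφ hf hφ_bdd hf_bdd, integral_terminal hφ hf hφ_bdd hf_bdd] at h1
  have h2 := htan q hq q' hq'
  have h3 : ∑ i : Fin n, (c' i - c i) *
        (budget Θ γ i - tiltEntropy μ c' (terminal Φ φ f q') (i + 1)) =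
      ∑ i, c' i * budget Θ γ i - ∑ i, c i * budget Θ γ i -
        ∑ i : Fin n, (c' i - c i) * tiltEntropy μ c' (terminal Φ φ f q') (i + 1) := by
    rw [← Finset.sum_sub_distrib, ← Finset.sum_sub_distrib]
    exact Finset.sum_congr rfl fun i _ => by ring
  rw [parisi_invTail hγ_sum, parisi_invTail hγ_sum, h3]
  linarith

/-! ### First-order conditions at a minimum -/

section FirstOrder

variable {q : ℝ} {c : Fin n → ℝ} {Q : Set ℝ}

lemma sub_mul_single_sum (ε : ℝ) (k : Fin n) (F : Fin n → ℝ) :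
    ∑ i, ((c + Pi.single k ε : Fin n → ℝ) i - c i) * F i = ε * F k := by
  rw [Finset.sum_eq_single k]
  · simp
  · intro i _ hi; simp [Pi.single_eq_of_ne hi]
  · simp

/-- Complementary slackness: increasing c_k is always allowed and gives feasibility; decreasing it
is allowed only when c_k > 0 and gives the reverse inequality. -/
lemma budget_sub_tiltEntropy_of_isMinOn (hγ_sum : ∑ k, γ k = 1)
    (hφ : Measurable φ) (hf : Measurable f) (hφ_bdd : ∃ C, ∀ x, |φ x| ≤ C)
    (hf_bdd : ∃ C, ∀ x, |f x| ≤ C) (hΦ' : Differentiable ℝ (deriv Φ))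
    (htan : ∀ q ∈ Q, ∀ t ∈ Q, Φ t ≤ Φ q + deriv Φ q * (t - q))
    (hC : ∀ q ∈ Q, ∀ x, |terminal Φ φ f q x| ≤ C) (hq : q ∈ Q) (hc : 0 ≤ c)
    (hmin : IsMinOn (fun p => parisi Θ γ Φ φ f μ (p.1, invTail p.2)) (Q ×ˢ Set.Ici 0) (q, c))
    (k : Fin n) :
    tiltEntropy μ c (terminal Φ φ f q) (k + 1) ≤ budget Θ γ k ∧
      (0 < c k → budget Θ γ k ≤ tiltEntropy μ c (terminal Φ φ f q) (k + 1)) := by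
  have key : ∀ ε : ℝ, 0 ≤ c + Pi.single k ε →
      0 ≤ ε * (budget Θ γ k - tiltEntropy μ (c + Pi.single k ε) (terminal Φ φ f q) (k + 1)) := by
    intro ε hε
    have h1 := parisi_sub_le (μ := μ) (Θ := Θ) hγ_sum hφ hf hφ_bdd hf_bdd htan hC hq hq hc hε
    rw [sub_self, zero_mul, zero_add, sub_mul_single_sum] at h1
    have h2 := isMinOn_iff.1 hmin (q, c + Pi.single k ε) (Set.mk_mem_prod hq hε)
    dsimp only at h2
    linarith
  have hlim : ∀ s : Set ℝ, (∀ ε ∈ s, 0 ≤ c + Pi.single k ε) →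
      Tendsto (fun ε => tiltEntropy μ (c + Pi.single k ε) (terminal Φ φ f q) (k + 1)) (𝓝[s] 0)
        (𝓝 (tiltEntropy μ c (terminal Φ φ f q) (k + 1))) := by
    intro s hs
    have hcont : ContinuousWithinAt
        (fun p : ℝ × (Fin n → ℝ) => tiltEntropy μ p.2 (terminal Φ φ f p.1) (k + 1))
        (Q ×ˢ Set.Ici 0) (q, c) :=
      continuousOn_tiltEntropy hφ hf hΦ' hC (k + 1) _ (Set.mk_mem_prod hq hc)
    have hpath : Tendsto (fun ε : ℝ => (q, c + Pi.single k ε)) (𝓝[s] 0)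
        (𝓝[Q ×ˢ Set.Ici 0] (q, c)) := by
      refine tendsto_nhdsWithin_iff.2 ⟨?_, ?_⟩
      · have h : Continuous fun ε : ℝ => (q, c + Pi.single k ε) :=
          continuous_const.prodMk (continuous_const.add (continuous_single (A := fun _ : Fin n => ℝ) k))
        have h0 := h.tendsto 0
        rw [Pi.single_zero, add_zero] at h0
        exact h0.mono_left nhdsWithin_le_nhds
      · exact eventually_mem_nhdsWithin.mono fun ε hε => Set.mk_mem_prod hq (hs ε hε)
    have h := hcont.tendsto.comp hpath
    simp only [Function.comp_def] at h
    exact h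
  constructor
  · refine le_of_tendsto (hlim (Set.Ioi 0) fun ε hε =>
      add_nonneg hc (Pi.single_nonneg.2 (le_of_lt hε))) ?_
    filter_upwards [self_mem_nhdsWithin] with ε hε
    have := nonneg_of_mul_nonneg_right
      (key ε (add_nonneg hc (Pi.single_nonneg.2 (le_of_lt hε)))) hε
    linarith
  · intro hk
    have hpos : ∀ ε ∈ Set.Ioo (-c k) 0, 0 ≤ c + Pi.single k ε := by
      intro ε hε i
      by_cases h : i = k
      · subst h; simp only [Pi.zero_apply, Pi.add_apply, Pi.single_eq_same]; linarith [hε.1]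
      · simpa [Pi.single_eq_of_ne h] using hc i
    have : (𝓝[Set.Ioo (-c k) 0] (0 : ℝ)).NeBot := by
      rw [nhdsWithin_Ioo_eq_nhdsLT (by linarith)]; infer_instance
    refine ge_of_tendsto (hlim _ hpos) ?_
    filter_upwards [self_mem_nhdsWithin] with ε hε
    have h0 := key ε (hpos ε hε)
    nlinarith [hε.2]

/-- Moving q to either side gives one inequality each, since strict monotonicity of Φ' fixes the
sign of the first factor in `key`. -/
lemma overlap_eq_of_isMinOn (hγ_sum : ∑ k, γ k = 1)
    (hφ : Measurable φ) (hf : Measurable f) (hφ_bdd : ∃ C, ∀ x, |φ x| ≤ C)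
    (hf_bdd : ∃ C, ∀ x, |f x| ≤ C) (hΦ : Differentiable ℝ Φ) (hΦ' : Differentiable ℝ (deriv Φ))
    (hanti : StrictAntiOn (deriv Φ) (Set.Icc (⨅ x, φ x) (⨆ x, φ x)))
    (hC : ∀ q ∈ Set.Icc (⨅ x, φ x) (⨆ x, φ x), ∀ x, |terminal Φ φ f q x| ≤ C)
    (hq : q ∈ Set.Icc (⨅ x, φ x) (⨆ x, φ x)) (hc : 0 ≤ c)
    (hmin : IsMinOn (fun p => parisi Θ γ Φ φ f μ (p.1, invTail p.2))
      (Set.Icc (⨅ x, φ x) (⨆ x, φ x) ×ˢ Set.Ici 0) (q, c)) :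
    ∫ x, φ x ∂tilt μ (invTail c) (terminal Φ φ f q) n = q := by
  have key : ∀ q' ∈ Set.Icc (⨅ x, φ x) (⨆ x, φ x), 0 ≤ (deriv Φ q - deriv Φ q') *
      (q' - ∫ x, φ x ∂tilt μ (invTail c) (terminal Φ φ f q') n) := by
    intro q' hq'
    have h1 := parisi_sub_le (μ := μ) (Θ := Θ) hγ_sum hφ hf hφ_bdd hf_bdd
      (fun q hq t ht => le_tangent hΦ hanti hq ht) hC hq hq' hc hc
    simp only [sub_self, zero_mul, Finset.sum_const_zero, add_zero] at h1
    have h2 := isMinOn_iff.1 hmin (q', c) (Set.mk_mem_prod hq' hc)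
    dsimp only at h2
    linarith
  have hlim : ∀ s ⊆ Set.Icc (⨅ x, φ x) (⨆ x, φ x),
      Tendsto (fun q' => ∫ x, φ x ∂tilt μ (invTail c) (terminal Φ φ f q') n) (𝓝[s] q)
        (𝓝 (∫ x, φ x ∂tilt μ (invTail c) (terminal Φ φ f q) n)) := by
    intro s hs
    have hcont : ContinuousWithinAt
        (fun p : ℝ × (Fin n → ℝ) => ∫ x, φ x ∂tilt μ (invTail p.2) (terminal Φ φ f p.1) n)
        (Set.Icc (⨅ x, φ x) (⨆ x, φ x) ×ˢ Set.Ici 0) (q, c) :=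
      continuousOn_overlap hφ hf hφ_bdd hΦ' hC _ (Set.mk_mem_prod hq hc)
    have hpath : Tendsto (fun q' : ℝ => (q', c)) (𝓝[s] q)
        (𝓝[Set.Icc (⨅ x, φ x) (⨆ x, φ x) ×ˢ Set.Ici 0] (q, c)) := by
      refine tendsto_nhdsWithin_iff.2 ⟨?_, ?_⟩
      · exact ((continuous_id.prodMk continuous_const).tendsto q).mono_left nhdsWithin_le_nhds
      · exact eventually_mem_nhdsWithin.mono fun q' hq' => Set.mk_mem_prod (hs hq') hc
    have h := hcont.tendsto.comp hpath
    simp only [Function.comp_def] at h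
    exact h
  have := isProbabilityMeasure_tilt (μ := μ) (invTail_pos hc) (measurable_terminal hφ hf q)
    (hC q hq) le_rfl
  have hmem := integral_mem_Icc hφ hφ_bdd (tilt μ (invTail c) (terminal Φ φ f q) n)
  apply le_antisymm
  -- If q is the right endpoint it cannot be increased, but then the mean of φ is at most sup φ = q
  -- anyway; the left endpoint is symmetric.
  · rcases hq.2.eq_or_lt with h | h
    · exact hmem.2.trans h.ge
    · have hne : (𝓝[Set.Ioo q (⨆ x, φ x)] q).NeBot := by
        rw [nhdsWithin_Ioo_eq_nhdsGT h]; infer_instance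
      have hs : Set.Ioo q (⨆ x, φ x) ⊆ Set.Icc (⨅ x, φ x) (⨆ x, φ x) :=
        fun t ht => ⟨hq.1.trans ht.1.le, ht.2.le⟩
      refine le_of_tendsto_of_tendsto (hlim _ hs)
        (tendsto_id.mono_left nhdsWithin_le_nhds) ?_
      filter_upwards [self_mem_nhdsWithin] with t ht
      exact sub_nonneg.1 (nonneg_of_mul_nonneg_right (key t (hs ht))
        (sub_pos.2 (hanti hq (hs ht) ht.1)))
  · rcases hq.1.eq_or_lt with h | h
    · exact h.ge.trans hmem.1
    · have hne : (𝓝[Set.Ioo (⨅ x, φ x) q] q).NeBot := by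
        rw [nhdsWithin_Ioo_eq_nhdsLT h]; infer_instance
      have hs : Set.Ioo (⨅ x, φ x) q ⊆ Set.Icc (⨅ x, φ x) (⨆ x, φ x) :=
        fun t ht => ⟨ht.1.le, ht.2.le.trans hq.2⟩
      refine le_of_tendsto_of_tendsto
        (tendsto_id.mono_left nhdsWithin_le_nhds) (hlim _ hs) ?_
      filter_upwards [self_mem_nhdsWithin] with t ht
      have h1 := key t (hs ht)
      have h2 := hanti (hs ht) hq ht.2
      simp only [id]
      nlinarith

end FirstOrder

end Gibbs

end GREM

/-! ### Strong duality and uniqueness -/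

open GREM in
theorem theorem2 (n : ℕ) (Θ : ℝ) (hΘ : 0 < Θ)
    (γ : Fin n → ℝ) (hγ : ∀ k, 0 < γ k) (hγ_sum : ∑ k, γ k = 1)
    (μ : Fin n → Measure ℝ) (hμ : ∀ k, IsProbabilityMeasure (μ k))
    (φ f : (Fin n → ℝ) → ℝ) (hφ : Measurable φ) (hf : Measurable f)
    (hφ_bdd : ∃ C, ∀ x, |φ x| ≤ C) (hf_bdd : ∃ C, ∀ x, |f x| ≤ C)
    (Φ : ℝ → ℝ) (hΦ : Differentiable ℝ Φ) (hΦ' : Differentiable ℝ (deriv Φ))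
    (hΦ'' : ∀ q ∈ Set.Icc (⨅ x, φ x) (⨆ x, φ x), deriv (deriv Φ) q < 0) :
    -- the variational principle
    sSup (GREM.gibbs Φ φ f μ '' GREM.admissible Θ γ μ) =
      sInf (GREM.parisi Θ γ Φ φ f μ '' GREM.domain φ) ∧
    -- the Parisi function has a minimum point
    (∃ p ∈ GREM.domain φ, IsMinOn (GREM.parisi Θ γ Φ φ f μ) (GREM.domain φ) p) ∧
    -- every minimum point gives the unique maximizer of the Gibbs problem
    (∀ p ∈ GREM.domain φ, IsMinOn (GREM.parisi Θ γ Φ φ f μ) (GREM.domain φ) p →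
      GREM.tilted Φ φ f μ p ∈ GREM.admissible Θ γ μ ∧
      ∀ ν ∈ GREM.admissible Θ γ μ, ν ≠ GREM.tilted Φ φ f μ p →
        GREM.gibbs Φ φ f μ ν < GREM.gibbs Φ φ f μ (GREM.tilted Φ φ f μ p)) := by
  have hn : 0 < n := by
    rcases n.eq_zero_or_pos with rfl | h
    · simp at hγ_sum
    · exact h
  obtain ⟨C, hC⟩ := exists_abs_terminal_le (n := n) (φ := φ) (f := f) hΦ' hφ_bdd hf_bdd
    (isCompact_Icc (a := ⨅ x, φ x) (b := ⨆ x, φ x))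
  have hanti := strictAntiOn_deriv_of_deriv_deriv_neg hΦ' hΦ''
  have main : ∀ p ∈ domain φ, IsMinOn (parisi Θ γ Φ φ f μ) (domain φ) p →
      tilted Φ φ f μ p ∈ admissible Θ γ μ ∧
      gibbs Φ φ f μ (tilted Φ φ f μ p) = parisi Θ γ Φ φ f μ p ∧
      ∀ ν ∈ admissible Θ γ μ, gibbs Φ φ f μ ν ≤ parisi Θ γ Φ φ f μ p ∧
        (ν ≠ tilted Φ φ f μ p → gibbs Φ φ f μ ν < parisi Θ γ Φ φ f μ p) := by
    rintro ⟨q, m⟩ ⟨hq, hm⟩ hmin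
    obtain ⟨c, hc, rfl⟩ := exists_invTail_eq hm
    have hg := measurable_terminal (Φ := Φ) hφ hf q
    have hmin' : IsMinOn (fun p => parisi Θ γ Φ φ f μ (p.1, invTail p.2))
        (Set.Icc (⨅ x, φ x) (⨆ x, φ x) ×ˢ Set.Ici 0) (q, c) := fun p hp =>
      hmin (show (p.1, invTail p.2) ∈ domain φ from ⟨hp.1, invTail_mem_simplex hp.2⟩)
    rw [tilted_eq_tilt Φ φ f (q, invTail c) (invTail_pos hc) hg (hC q hq)]
    set G := tilt μ (invTail c) (terminal Φ φ f q) n with hG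
    have hGprob : IsProbabilityMeasure G :=
      isProbabilityMeasure_tilt (invTail_pos hc) hg (hC q hq) le_rfl
    have hover : ∫ x, φ x ∂G = q :=
      overlap_eq_of_isMinOn hγ_sum hφ hf hφ_bdd hf_bdd hΦ hΦ' hanti hC hq hc hmin'
    have hent := budget_sub_tiltEntropy_of_isMinOn hγ_sum hφ hf hφ_bdd hf_bdd hΦ'
      (fun q hq t ht => le_tangent hΦ hanti hq ht) hC hq hc hmin'
    have hkl := klDiv_marginal_tilt (μ := μ) (invTail_pos hc) (invTail_le_one hc) hg (hC q hq)
    refine ⟨⟨hGprob, fun k => ?_⟩, ?_, fun ν hν => ?_⟩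
    · rw [(hkl (k + 1) k.isLt).1]
      exact ENNReal.ofReal_le_ofReal (hent k).1
    · have h1 := integral_terminal (Φ := Φ) hφ hf hφ_bdd hf_bdd q G
      have h2 := integral_eq_level_zero_add (μ := μ) hc hg (hC q hq) G
      have h3 := hkl n le_rfl
      rw [marginal_self n rfl] at h3
      -- Complementary slackness: a term either has multiplier zero or a saturated constraint.
      have h4 : ∑ i : Fin n, c i * ∫ x, logDensity μ (invTail c) (terminal Φ φ f q) (i + 1) x ∂G =
          ∑ i, c i * budget Θ γ i := by
        refine Finset.sum_congr rfl fun i _ => ?_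
        rcases (hc i).eq_or_lt with h | h
        · rw [← h]; simp
        · congr 1
          exact le_antisymm (hent i).1 ((hent i).2 h)
      rw [parisi_invTail hγ_sum, gibbs, h3.1, ENNReal.toReal_ofReal h3.2, hover]
      rw [hover] at h1
      linarith
    · have := hν.1
      have h1 := gibbs_le_parisi_add hΘ hγ hγ_sum hφ hf hφ_bdd hf_bdd hΦ hanti hq (hC q hq) hc hν
      obtain ⟨h2, h3⟩ := integral_le_toReal_klDiv (ν := ν) (μ := Measure.pi μ)
        (measurable_logDensity hg n)
        (abs_logDensity_le (invTail_pos hc) (invTail_le_one hc) hg (hC q hq) n)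
        (integral_exp_logDensity (invTail_pos hc) hg (hC q hq) le_rfl)
        (klDiv_ne_top_of_mem_admissible hn hν)
      refine ⟨by linarith, fun hne => ?_⟩
      -- Equality in Gibbs' inequality on all n coordinates would force ν = G, so any other ν loses
      -- strictly in weak duality.
      have h4 := lt_of_le_of_ne h2 fun h => hne (h3 h.symm)
      linarith
  have hexists : ∃ p ∈ domain φ, IsMinOn (parisi Θ γ Φ φ f μ) (domain φ) p := by
    obtain ⟨p, hp, hmin⟩ := exists_isMinOn_parisi (μ := μ) hΘ hγ hγ_sum hφ hf hΦ hΦ' isCompact_Icc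
      ⟨_, integral_mem_Icc hφ hφ_bdd (MeasureTheory.Measure.pi μ)⟩ hC
    refine ⟨(p.1, invTail p.2), ⟨hp.1, invTail_mem_simplex hp.2⟩, ?_⟩
    rintro ⟨q, m⟩ ⟨hq, hm⟩
    obtain ⟨c, hc, rfl⟩ := exists_invTail_eq hm
    exact hmin (show (q, c) ∈ _ ×ˢ Set.Ici (0 : Fin n → ℝ) from ⟨hq, hc⟩)
  refine ⟨?_, hexists, fun p hp hmin => ?_⟩
  · obtain ⟨p, hp, hmin⟩ := hexists
    obtain ⟨hadm, heq, hle⟩ := main p hp hmin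
    have h1 : IsGreatest (gibbs Φ φ f μ '' admissible Θ γ μ) (parisi Θ γ Φ φ f μ p) :=
      ⟨⟨_, hadm, heq⟩, by rintro _ ⟨ν, hν, rfl⟩; exact (hle ν hν).1⟩
    have h2 : IsLeast (parisi Θ γ Φ φ f μ '' domain φ) (parisi Θ γ Φ φ f μ p) :=
      ⟨⟨p, hp, rfl⟩, by rintro _ ⟨p', hp', rfl⟩; exact hmin hp'⟩
    rw [h1.csSup_eq, h2.csInf_eq]
  · obtain ⟨hadm, heq, hle⟩ := main p hp hmin
    exact ⟨hadm, fun ν hν hne => heq ▸ (hle ν hν).2 hne⟩
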